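/- **Setting.** Let $X$ be a locally compact (Hausdorff) group with neutral element $e$, left Haar measure $dx$ and modular function $\Delta$ (so that $\Delta(x)^{-1}dx$ is the image of $dx$ under inversion). Let $A$ be a $C^*$-algebra with multiplier algebra $M(A)$, and let $\sigma$ be an action of $X$ on $A$ by $*$-automorphisms, with $x\mapsto\sigma_x a$ continuous for each $a\in A$. Automorphisms of $A$ are extended to $M(A)$. "Measurable" and "continuous" for $M(A)$-valued maps refer to the strict topology, and measurability of maps on $X\times X$ is understood in the strong sense on compact sets. A *right $C^*$-multiplier* (for $\sigma$) is a measurable map $\zeta$ from $X\times X$ to the unitaries of $M(A)$, continuous in a neighbourhood of $(e,e)$, with $\zeta(x,e)=\zeta(e,y)=1$, $$\sigma_y^{-1}\zeta(z,x)=\zeta(zx,y)^*\,\zeta(z,xy)\,\zeta(x,y),\qquad \sigma_x\sigma_y a=\sigma_{xy}\bigl(\zeta(x,y)\,a\,\zeta(x,y)^*\bigr)$$ for all $x,y,z\in X$ and $a\in A$. A *state of the covariance system* $(A,X,\sigma)$ is a family $\omega=(\omega_{x,y})_{x,y\in X}$ of continuous linear functionals on $A$ such that $(x,y)\mapsto\omega_{x,y}(a)$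 is measurable on $X\times X$ and continuous in a neighbourhood of $(e,e)$ for each $a\in A$; $\sum_{j,k=1}^n\lambda_j\overline{\lambda_k}\,\omega_{x_j,x_k}(a_k^*a_j)\ge 0$ for all $n$, $\lambda_j\in\mathbb C$, $x_j\in X$, $a_j\in A$; $\omega_{e,e}$ is a state of $A$; and there is a right $C^*$-multiplier $\zeta$ with $$\omega_{x,y}(\sigma_z a)=\omega_{xz,yz}\bigl(\zeta(y,z)\,a\,\zeta(x,z)^*\bigr)\qquad(x,y,z\in X,\ a\in A).$$ Such a $\zeta$ is said to be associated with $\omega$, and $\xi(x,y)=\sigma_{xy}\zeta(x,y)$ is the left multiplier derived from it. With the operations $$(f\times g)(x)=\int_X f(y)\,\xi(y,y^{-1}x)\,\sigma_y g(y^{-1}x)\,dy,\qquad f^\star(x)=\Delta(x)^{-1}\,\xi(x,x^{-1})^*\,\sigma_x\bigl(f(x^{-1})^*\bigr)$$ on $L^1(X,A)$, the *twisted crossed product* $A\times_\xi X$ is the $C^*$-algebra obtained by completing (the quotient by the null space of) $L^1(X,A)$ in the largest $C^*$-seminorm $\|f\|=\sup_\pi\|\pi(f)\|$, where $\pi$ runs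 over the contractive $*$-representations of $L^1(X,A)$ on Hilbert spaces. **Proposition.** Let $\omega$ be a state of the covariance system $(A,X,\sigma)$, let $\zeta$ be a right $C^*$-multiplier associated with $\omega$, and let $\xi$ be the left multiplier derived from $\zeta$. Then: 1. $f\times g$ and $f^\star$ are well defined elements of $L^1(X,A)$ for all $f,g\in L^1(X,A)$ (the integral defining $(f\times g)(x)$ converges absolutely for almost every $x$). 2. For every $f\in L^1(X,A)$ the integrand in $$\overline\omega(f)=\int_X\Delta(x)^{-1}\,\omega_{x,e}\bigl(\xi(x^{-1},x)\,f(x^{-1})\bigr)\,dx$$ is integrable, and $\overline\omega$ is a bounded linear functional on $L^1(X,A)$ that is positive, $\overline\omega(f^\star\times f)\ge0$ for all $f$, and normalized, $\|\overline\omega\|=1$. 3. $\overline\omega$ extends to a state of $A\times_\xi X$: there is a state $\varphi$ of $A\times_\xi X$ whose value at the canonical image of $f$ is $\overline\omega(f)$, for every $f\in L^1(X,A)$. -/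

import Mathlib

open MeasureTheory Topology
open scoped MultiplierAlgebra ComplexOrder ENNReal

noncomputable section

namespace TwistedCovariance

universe u v w

/-- A state of a `C*`-algebra: a positive linear functional of norm one. -/
def IsState {B : Type w} [NonUnitalCStarAlgebra B] (φ : B →L[ℂ] ℂ) : Prop :=
  (∀ b : B, 0 ≤ φ (star b * b)) ∧ ‖φ‖ = 1

section Multipliers

variable {A : Type v} [NonUnitalCStarAlgebra A]

/-- A `*`-automorphism of a `C*`-algebra as a continuous linear map. -/
def autCLM (α : A ≃⋆ₐ[ℂ] A) : A →L[ℂ] A where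
  toFun := α
  map_add' := map_add α
  map_smul' := map_smul α
  cont := (NonUnitalStarAlgHom.isometry (F := A ≃⋆ₐ[ℂ] A) α α.injective).continuous

/-- The canonical extension of a `*`-automorphism `α` of `A` to the multiplier algebra of `A`:
`α(m) a = α (m (α⁻¹ a))` and `a α(m) = α ((α⁻¹ a) m)`. -/
def autMultiplier (α : A ≃⋆ₐ[ℂ] A) (m : 𝓜(ℂ, A)) : 𝓜(ℂ, A) where
  fst := autCLM α ∘L m.fst ∘L autCLM α.symm
  snd := autCLM α ∘L m.snd ∘L autCLM α.symm
  central := fun x y => by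
    change α (m.snd (α.symm x)) * y = x * α (m.fst (α.symm y))
    have h := congrArg α (m.central (α.symm x) (α.symm y))
    simpa only [map_mul, StarAlgEquiv.apply_symm_apply] using h

/-- The product `m a ∈ A` of `m ∈ M(A)` and `a ∈ A`. -/
def mulLeft (m : 𝓜(ℂ, A)) (a : A) : A := m.fst a

/-- The product `a m ∈ A` of `a ∈ A` and `m ∈ M(A)`. -/
def mulRight (a : A) (m : 𝓜(ℂ, A)) : A := m.snd a

end Multipliers

section Group

variable {X : Type u} [Group X] [TopologicalSpace X] [MeasurableSpace X]
variable {A : Type v} [NonUnitalCStarAlgebra A]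

/-- Measurability of a map `F` on `X × X` with values in a normed space: over each compact set `K`,
the restriction of `F` to `K × K` is a pointwise limit of measurable simple functions.
For `X` second countable and `E` separable this is Borel measurability of `F`. -/
def MeasurableOnCompacts {E : Type w} [NormedAddCommGroup E] (F : X × X → E) : Prop :=
  ∀ K : Set X, IsCompact K → StronglyMeasurable ((K ×ˢ K).indicator F)

/-- Right `C*`-multipliers `ζ` of `X` with values in the unitary elements of `M(A)`, with associated
twisted representation `σ`. Measurability, and continuity near the neutral element, refer to the
strict topology of `M(A)`. -/
structure IsRightMultiplier (σ : X → A ≃⋆ₐ[ℂ] A) (ζ : X → X → 𝓜(ℂ, A)) : Prop where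
  aut_one : ∀ a, σ 1 a = a
  unitary : ∀ x y, ζ x y ∈ unitary 𝓜(ℂ, A)
  right_one : ∀ x, ζ x 1 = 1
  one_left : ∀ y, ζ 1 y = 1
  measurable_left : ∀ a, MeasurableOnCompacts fun p : X × X => mulLeft (ζ p.1 p.2) a
  measurable_right : ∀ a, MeasurableOnCompacts fun p : X × X => mulRight a (ζ p.1 p.2)
  cocycle : ∀ x y z,
    autMultiplier (σ y).symm (ζ z x) = star (ζ (z * x) y) * ζ z (x * y) * ζ x y
  twist : ∀ x y a,
    σ x (σ y a) = σ (x * y) (mulRight (mulLeft (ζ x y) a) (star (ζ x y)))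
  continuous_near_one : ∃ V ∈ 𝓝 ((1 : X), (1 : X)), ∀ a,
    ContinuousOn (fun p : X × X => mulLeft (ζ p.1 p.2) a) V ∧
    ContinuousOn (fun p : X × X => mulRight a (ζ p.1 p.2)) V

/-- The right multiplier `ζ` implements the covariance of the family of functionals `ω`:
`ω_{x,y}(σ_z a) = ω_{xz,yz}(ζ(y,z) a ζ(x,z)*)`. -/
structure IsAssociatedMultiplier (σ : X → A ≃⋆ₐ[ℂ] A) (ω : X → X → (A →L[ℂ] ℂ))
    (ζ : X → X → 𝓜(ℂ, A)) : Prop where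
  isRightMultiplier : IsRightMultiplier σ ζ
  covariant : ∀ x y z a,
    ω x y (σ z a) = ω (x * z) (y * z) (mulRight (mulLeft (ζ y z) a) (star (ζ x z)))

/-- States of the covariance system `(A, X, σ)`. -/
structure IsCovarianceState (σ : X → A ≃⋆ₐ[ℂ] A) (ω : X → X → (A →L[ℂ] ℂ)) : Prop where
  measurable : ∀ a, MeasurableOnCompacts fun p : X × X => ω p.1 p.2 a
  positive : ∀ (n : ℕ) (c : Fin n → ℂ) (x : Fin n → X) (a : Fin n → A),
    0 ≤ ∑ j, ∑ k, c j * star (c k) * ω (x j) (x k) (star (a k) * a j)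
  normalized : IsState (ω 1 1)
  covariant : ∃ ζ : X → X → 𝓜(ℂ, A), IsAssociatedMultiplier σ ω ζ
  continuous_near_one : ∀ a, ∃ V ∈ 𝓝 ((1 : X), (1 : X)),
    ContinuousOn (fun p : X × X => ω p.1 p.2 a) V

/-- The left multiplier derived from a right multiplier `ζ`, that is `ξ(x,y) = σ_{xy} ζ(x,y)`. -/
def leftMultiplier (σ : X → A ≃⋆ₐ[ℂ] A) (ζ : X → X → 𝓜(ℂ, A)) (x y : X) : 𝓜(ℂ, A) :=
  autMultiplier (σ (x * y)) (ζ x y)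

end Group

section CrossedProduct

variable {X : Type u} [Group X] [TopologicalSpace X] [IsTopologicalGroup X] [LocallyCompactSpace X]

/-- The modular function `Δ`, normalized by `μ (E x) = Δ(x) μ(E)` for left Haar measures `μ`, so that
`Δ(x)⁻¹ dx` is the image of the left Haar measure `dx` under inversion. Mathlib's
`modularCharacter x` is the factor for `E ↦ μ (E x⁻¹)`, whence the inverse. -/
def modularFunction (x : X) : ℝ := ((Measure.modularCharacter x : NNReal) : ℝ)⁻¹

variable [MeasurableSpace X] {A : Type v} [NonUnitalCStarAlgebra A]

/-- The integrand `y ↦ f(y) ξ(y, y⁻¹x) σ_y g(y⁻¹x)` of the twisted convolution. -/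
def convIntegrand (σ : X → A ≃⋆ₐ[ℂ] A) (ξ : X → X → 𝓜(ℂ, A)) (f g : X → A) (x y : X) : A :=
  f y * mulLeft (ξ y (y⁻¹ * x)) (σ y (g (y⁻¹ * x)))

/-- The twisted convolution `(f × g)(x) = ∫ f(y) ξ(y, y⁻¹x) σ_y g(y⁻¹x) dy`. -/
def conv (μ : Measure X) (σ : X → A ≃⋆ₐ[ℂ] A) (ξ : X → X → 𝓜(ℂ, A)) (f g : X → A) (x : X) : A :=
  ∫ y, convIntegrand σ ξ f g x y ∂μ

/-- The twisted involution `f⋆(x) = Δ(x)⁻¹ ξ(x, x⁻¹)* σ_x (f(x⁻¹)*)`. -/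
def involution (σ : X → A ≃⋆ₐ[ℂ] A) (ξ : X → X → 𝓜(ℂ, A)) (f : X → A) (x : X) : A :=
  (modularFunction x)⁻¹ • mulLeft (star (ξ x x⁻¹)) (σ x (star (f x⁻¹)))

/-- `L¹(X, A)`. -/
abbrev L1 (A : Type v) [NonUnitalCStarAlgebra A] (μ : Measure X) : Type (max u v) := Lp A 1 μ

open Classical in
/-- The twisted convolution on `L¹(X, A)`. (For a measurable multiplier the convolution of two
integrable functions is always integrable.) -/
def L1.conv (μ : Measure X) (σ : X → A ≃⋆ₐ[ℂ] A) (ξ : X → X → 𝓜(ℂ, A)) (f g : L1 A μ) : L1 A μ :=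
  if h : Integrable (TwistedCovariance.conv μ σ ξ f g) μ then h.toL1 _ else 0

open Classical in
/-- The twisted involution on `L¹(X, A)`. (For a measurable multiplier the involution preserves
integrability.) -/
def L1.involution (μ : Measure X) (σ : X → A ≃⋆ₐ[ℂ] A) (ξ : X → X → 𝓜(ℂ, A)) (f : L1 A μ) :
    L1 A μ :=
  if h : Integrable (TwistedCovariance.involution σ ξ f) μ then h.toL1 _ else 0

/-- A contractive `*`-representation of the involutive algebra `L¹(X, A)`, with twisted convolution
and twisted involution, on a Hilbert space. -/
structure L1Rep (μ : Measure X) (σ : X → A ≃⋆ₐ[ℂ] A) (ξ : X → X → 𝓜(ℂ, A)) where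
  H : Type (max u v)
  [normedAddCommGroup : NormedAddCommGroup H]
  [innerProductSpace : InnerProductSpace ℂ H]
  [completeSpace : CompleteSpace H]
  rep : L1 A μ →ₗ[ℂ] (H →L[ℂ] H)
  norm_rep_le : ∀ f, ‖rep f‖ ≤ ‖f‖
  map_conv : ∀ f g, rep (L1.conv μ σ ξ f g) = rep f * rep g
  map_involution : ∀ f, rep (L1.involution μ σ ξ f) = star (rep f)

attribute [instance] L1Rep.normedAddCommGroup L1Rep.innerProductSpace L1Rep.completeSpace

/-- The `C*`-algebra `∏ B(H_π)` of bounded families of operators, over all representations `π` of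
`L¹(X, A)`. -/
def RepProduct (μ : Measure X) (σ : X → A ≃⋆ₐ[ℂ] A) (ξ : X → X → 𝓜(ℂ, A)) : Type (max u v + 1) :=
  lp (fun π : L1Rep μ σ ξ => π.H →L[ℂ] π.H) ∞

instance (μ : Measure X) (σ : X → A ≃⋆ₐ[ℂ] A) (ξ : X → X → 𝓜(ℂ, A)) :
    NonUnitalCStarAlgebra (RepProduct μ σ ξ) :=
  inferInstanceAs (NonUnitalCStarAlgebra (lp (fun π : L1Rep μ σ ξ => π.H →L[ℂ] π.H) ∞))

/-- The universal representation `f ↦ (π(f))_π` of `L¹(X, A)`. The norm of the image of `f` is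
`sup_π ‖π(f)‖`. -/
def universalRep (μ : Measure X) (σ : X → A ≃⋆ₐ[ℂ] A) (ξ : X → X → 𝓜(ℂ, A)) :
    L1 A μ →ₗ[ℂ] RepProduct μ σ ξ where
  toFun f := ⟨fun π => π.rep f, memℓp_infty ⟨‖f‖, by
    rintro _ ⟨π, rfl⟩
    exact π.norm_rep_le f⟩⟩
  map_add' f g := Subtype.ext (funext fun π => map_add π.rep f g)
  map_smul' c f := Subtype.ext (funext fun π => map_smul π.rep c f)

/-- The image of `L¹(X, A)` under its universal representation, a `*`-algebra of operators. -/
def universalImage (μ : Measure X) (σ : X → A ≃⋆ₐ[ℂ] A) (ξ : X → X → 𝓜(ℂ, A)) :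
    NonUnitalStarSubalgebra ℂ (RepProduct μ σ ξ) where
  carrier := Set.range (universalRep μ σ ξ)
  add_mem' := by
    rintro _ _ ⟨f, rfl⟩ ⟨g, rfl⟩
    exact ⟨f + g, map_add _ f g⟩
  zero_mem' := ⟨0, map_zero _⟩
  mul_mem' := by
    rintro _ _ ⟨f, rfl⟩ ⟨g, rfl⟩
    exact ⟨L1.conv μ σ ξ f g, Subtype.ext (funext fun π => π.map_conv f g)⟩
  smul_mem' := by
    rintro c _ ⟨f, rfl⟩
    exact ⟨c • f, map_smul _ c f⟩
  star_mem' := by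
    rintro _ ⟨f, rfl⟩
    exact ⟨L1.involution μ σ ξ f, Subtype.ext (funext fun π => π.map_involution f)⟩

/-- The twisted crossed product `A ×_ξ X`: the completion of (the quotient by the null space of)
`L¹(X, A)` in the largest `C*`-seminorm `f ↦ sup_π ‖π(f)‖`, realized as the closure of the image of
the universal representation. -/
abbrev CrossedProduct (μ : Measure X) (σ : X → A ≃⋆ₐ[ℂ] A) (ξ : X → X → 𝓜(ℂ, A)) :=
  (universalImage μ σ ξ).topologicalClosure

instance (μ : Measure X) (σ : X → A ≃⋆ₐ[ℂ] A) (ξ : X → X → 𝓜(ℂ, A)) :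
    NonUnitalCStarAlgebra (CrossedProduct μ σ ξ) :=
  NonUnitalStarSubalgebra.nonUnitalCStarAlgebra _
    (h_closed := NonUnitalStarSubalgebra.isClosed_topologicalClosure _)

/-- The canonical map of `L¹(X, A)` into `A ×_ξ X`. -/
def toCrossedProduct (μ : Measure X) (σ : X → A ≃⋆ₐ[ℂ] A) (ξ : X → X → 𝓜(ℂ, A)) (f : L1 A μ) :
    CrossedProduct μ σ ξ :=
  ⟨universalRep μ σ ξ f, NonUnitalStarSubalgebra.le_topologicalClosure _ ⟨f, rfl⟩⟩

/-- The integrand `x ↦ Δ(x)⁻¹ ω_{x,e}(ξ(x⁻¹, x) f(x⁻¹))` of the functional `ω̄`. -/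
def stateIntegrand (ω : X → X → (A →L[ℂ] ℂ)) (ξ : X → X → 𝓜(ℂ, A)) (f : X → A) (x : X) : ℂ :=
  (modularFunction x)⁻¹ • ω x 1 (mulLeft (ξ x⁻¹ x) (f x⁻¹))

end CrossedProduct

end TwistedCovariance

end

/-!
The functional `ω̄` is a vector functional of a representation of `L¹(X, A)`, and everything follows
from that.

Since `σ` is multiplicative, the relation `σ_x σ_y a = σ_{xy}(ζ(x,y) a ζ(x,y)*)` forces every
`ζ(x,y)` to commute with `A` (`IsRightMultiplier.isCentralUnitary`). The positivity of `ω` makes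
`⟨v(w,c), v(x,b)⟩ = ω_{x,w}(c* b)` a positive definite kernel on `X × A`, with Hilbert space `H`. The
covariance of `ω` and the cocycle identity of `ζ` turn
`T_z(a) v(x,b) = v(x z⁻¹, a σ_z(ζ(x z⁻¹,z) b))` into operators on `H` with `‖T_z(a)‖ ≤ ‖a‖`,
`T_y(a) T_z(b) = T_{yz}(a ξ(y,z) σ_y b)` (`gnsOp_mul`) and
`T_z(a)* = T_{z⁻¹}(ζ(z⁻¹,z)* σ_z⁻¹(a*))` (`adjoint_gnsOp`). These are the pointwise forms of the
twisted product and involution, so that the weak integral `π(f) = ∫ T_y(f(y)) dy` is a contractive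
`*`-representation of `L¹(X, A)` (`gnsRepOp_conv`, `gnsRepOp_involution`). An approximate unit of `A`
yields a vector `Ω` in the unit ball with `⟨Ω, v(x,a)⟩ = ω_{x,e}(a)`, whence
`⟨Ω, T_z(a) Ω⟩ = ω_{z⁻¹,e}(ζ(z,z⁻¹) a)` and `ω̄(f) = ⟨Ω, π(f) Ω⟩`. Positivity and `‖ω̄‖ ≤ 1` are then
clear, the functions `1_V ⊗ a` with `V` a small neighbourhood of `e` give `‖ω̄‖ ≥ 1`
(`one_le_norm_stateFunctional`), and the state of the crossed product is `S ↦ ⟨Ω, S_π Ω⟩`.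

The analytic difficulty is that `X` need not be second countable: the multiplication of `X` need not be
measurable for the product `σ`-algebra, and `dx` need not be `σ`-finite. An integrable function vanishes
outside an open `σ`-compact subgroup `G` (`exists_subgroup_ae_eq_zero`). On `G` the substitution
`(x, y) ↦ (y, y⁻¹ x)` of Fubini's theorem is replaced by the kernel that sends `x` to the image of `dy`
under `y ↦ (y, y⁻¹ x)`; this kernel disintegrates the product measure (`bind_shearMeasure`). The
integrands themselves are measurable in two variables, since pairing with the vectors `v(x,b)` expresses
them through `ω` and `ζ` at translates of the two variables (`inner_gnsOp_gnsOp`), with no products of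
the variables involved.
-/

noncomputable section

namespace TwistedCovariance

/-! ### Haar measure and inversion -/

section GroupMeasure

open Measure Set Filter
open scoped NNReal Pointwise

set_option linter.unusedSectionVars false

variable {X : Type*} [Group X] [TopologicalSpace X] [IsTopologicalGroup X] [LocallyCompactSpace X]
  [T2Space X] [MeasurableSpace X] [BorelSpace X]

/-- The modular character is a quotient of integrals of a compactly supported continuous function,
the numerator being a convolution. -/
lemma continuous_modularCharacter : Continuous (modularCharacter : X → ℝ≥0) := by
  let μ : Measure X := haar
  obtain ⟨⟨f, f_cont⟩, f_comp, f_nonneg, f_one⟩ :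
    ∃ f : C(X, ℝ), HasCompactSupport f ∧ 0 ≤ f ∧ f 1 ≠ 0 := exists_continuous_nonneg_pos 1
  have hf0 : ∫ x, f x ∂μ ≠ 0 :=
    ne_of_gt (f_cont.integral_pos_of_hasCompactSupport_nonneg_nonzero f_comp f_nonneg f_one)
  have key : ∀ g : X, ((modularCharacter g : ℝ≥0) : ℝ)
      = (∫ y, f (y⁻¹ * g) ∂μ.inv) / ∫ x, f x ∂μ := by
    intro g
    have h1 : modularCharacter g = haarScalarFactor (map (· * g) μ) μ :=
      modularCharacterFun_eq_haarScalarFactor μ g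
    have h2 : ∫ y, f (y⁻¹ * g) ∂μ.inv = ∫ x, f (x * g) ∂μ := by
      have hc : Continuous fun y : X => f (y⁻¹ * g) := f_cont.comp (by fun_prop)
      rw [inv_def, integral_map measurable_inv.aemeasurable hc.aestronglyMeasurable]
      simp
    rw [h1, haarScalarFactor_eq_integral_div _ _ f_cont f_comp hf0, h2,
      integral_map (measurable_mul_const g).aemeasurable f_cont.aestronglyMeasurable]
  refine NNReal.isEmbedding_coe.continuous_iff.2 ?_
  have : ((fun r : ℝ≥0 => (r : ℝ)) ∘ (modularCharacter : X → ℝ≥0))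
      = fun g => (∫ y, f (y⁻¹ * g) ∂μ.inv) / ∫ x, f x ∂μ := funext key
  rw [this]
  exact (continuous_integral_apply_inv_mul f_cont f_comp).div_const _

variable (μ : Measure X) [μ.IsHaarMeasure] [μ.Regular]

lemma map_mul_right_eq_modularCharacter_smul (g : X) :
    map (· * g) μ = modularCharacter g • μ := by
  have h1 : modularCharacter g = haarScalarFactor (map (· * g) μ) μ :=
    modularCharacterFun_eq_haarScalarFactor μ g
  have : (map (· * g) μ).Regular := Regular.map (Homeomorph.mulRight g)
  rw [h1]
  exact isMulLeftInvariant_eq_smul_of_regular _ _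

/-- The measure `Δ(x)⁻¹ dx`. -/
def modularMeasure : Measure X := μ.withDensity fun x => (modularCharacter x : ℝ≥0∞)

lemma modularCharacter_ne_zero (x : X) : (modularCharacter x : ℝ≥0) ≠ 0 :=
  (modularCharacterFun_pos x).ne'

instance : IsMulRightInvariant (modularMeasure μ) := by
  have hm : Measurable fun x : X => (modularCharacter x : ℝ≥0∞) :=
    (continuous_modularCharacter (X := X)).measurable.coe_nnreal_ennreal
  refine ⟨fun g => ?_⟩
  ext s hs
  have hc : (modularCharacter g : ℝ≥0∞) ≠ 0 := by
    simpa using modularCharacter_ne_zero g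
  have hs' : MeasurableSet ((· * g) ⁻¹' s) := measurable_mul_const g hs
  rw [map_apply (measurable_mul_const g) hs, modularMeasure, withDensity_apply _ hs',
    withDensity_apply _ hs]
  refine (ENNReal.mul_right_inj hc ENNReal.coe_ne_top).1 ?_
  calc (modularCharacter g : ℝ≥0∞) * ∫⁻ x in (· * g) ⁻¹' s, modularCharacter x ∂μ
      = ∫⁻ x in (· * g) ⁻¹' s, modularCharacter (x * g) ∂μ := by
        rw [← lintegral_const_mul _ hm]
        refine lintegral_congr fun x => ?_
        rw [map_mul, ENNReal.coe_mul, mul_comm]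
    _ = ∫⁻ x in s, modularCharacter x ∂(map (· * g) μ) :=
        (setLIntegral_map hs hm (measurable_mul_const g)).symm
    _ = _ := by
        rw [map_mul_right_eq_modularCharacter_smul, restrict_smul, lintegral_smul_measure]
        rfl

instance : IsFiniteMeasureOnCompacts (modularMeasure μ) := by
  have : IsLocallyFiniteMeasure (modularMeasure μ) :=
    IsLocallyFiniteMeasure.withDensity_coe continuous_modularCharacter
  infer_instance

/-- The constant that uniqueness of Haar measure leaves open is `1`, because inversion is an
involution. -/
lemma haarScalarFactor_modularMeasure_inv : haarScalarFactor (modularMeasure μ).inv μ = 1 := by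
  set c := haarScalarFactor (modularMeasure μ).inv μ with hc
  have hmod := continuous_modularCharacter (X := X)
  have key : ∀ f : X → ℝ, Continuous f → HasCompactSupport f →
      ∫ x, (modularCharacter x : ℝ) * f x⁻¹ ∂μ = c * ∫ x, f x ∂μ := by
    intro f hf h'f
    have h := integral_isMulLeftInvariant_eq_smul_of_hasCompactSupport (modularMeasure μ).inv μ hf
      h'f
    have h2 : ∫ x, f x ∂(modularMeasure μ).inv = ∫ x, (modularCharacter x : ℝ) * f x⁻¹ ∂μ := by
      rw [inv_def, integral_map measurable_inv.aemeasurable hf.aestronglyMeasurable,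
        modularMeasure, integral_withDensity_eq_integral_smul hmod.measurable]
      rfl
    rw [integral_smul_nnreal_measure, h2] at h
    exact h
  obtain ⟨⟨f, f_cont⟩, f_comp, f_nonneg, f_one⟩ :
    ∃ f : C(X, ℝ), HasCompactSupport f ∧ 0 ≤ f ∧ f 1 ≠ 0 := exists_continuous_nonneg_pos 1
  have hf0 : 0 < ∫ x, f x ∂μ :=
    f_cont.integral_pos_of_hasCompactSupport_nonneg_nonzero f_comp f_nonneg f_one
  have hg : Continuous fun x : X => (modularCharacter x : ℝ) * f x⁻¹ :=
    (NNReal.continuous_coe.comp hmod).mul (f_cont.comp continuous_inv)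
  have hg' : HasCompactSupport fun x : X => (modularCharacter x : ℝ) * f x⁻¹ :=
    (f_comp.comp_homeomorph (Homeomorph.inv X)).mul_left
  have h2 := key _ hg hg'
  rw [key f f_cont f_comp] at h2
  have h3 : ∀ x : X, (modularCharacter x : ℝ) * ((modularCharacter x⁻¹ : ℝ≥0) * f x⁻¹⁻¹) = f x := by
    intro x
    rw [← mul_assoc, ← NNReal.coe_mul, ← map_mul]
    simp
  simp only [h3] at h2
  have h4 : (c : ℝ) * c = 1 := by
    apply mul_right_cancel₀ hf0.ne'
    rw [one_mul, mul_assoc]; exact h2.symm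
  have h5 : (c : ℝ) = 1 := by nlinarith [c.coe_nonneg]
  exact_mod_cast h5

/-- On sets with compact closure, `Δ(x)⁻¹ dx` is the image of `dx` under inversion. -/
lemma modularMeasure_inv_apply {s : Set X} (hs : IsCompact (closure s)) :
    modularMeasure μ s⁻¹ = μ s := by
  have h := measure_isMulInvariant_eq_smul_of_isCompact_closure (modularMeasure μ).inv μ hs
  rwa [haarScalarFactor_modularMeasure_inv, one_smul, inv_apply] at h

/-- The sets where the modular character is bounded below exhaust the group; on each of them an open
set of small measure has a small inverse, as one sees on its compact subsets. -/
lemma measure_inv_null_of_null {N : Set X} (hN : μ N = 0) : μ N⁻¹ = 0 := by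
  have hmod := continuous_modularCharacter (X := X)
  let W : ℕ → Set X := fun k => {x | ((k : ℝ≥0) + 1)⁻¹ < modularCharacter x}
  have hW : ∀ k, IsOpen (W k) := fun k => isOpen_lt continuous_const hmod
  have hcover : N⁻¹ ⊆ ⋃ k, N⁻¹ ∩ W k := by
    intro x hx
    obtain ⟨k, hk⟩ := exists_nat_one_div_lt (modularCharacterFun_pos x)
    refine mem_iUnion.2 ⟨k, hx, ?_⟩
    have hk' : ((k : ℝ≥0) + 1)⁻¹ < modularCharacterFun x := by simpa [one_div] using hk
    exact hk'
  refine measure_mono_null hcover (measure_iUnion_null fun k => ?_)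
  have hk0 : ((k : ℝ≥0∞) + 1) ≠ 0 := by simp
  have hkt : ((k : ℝ≥0∞) + 1) ≠ ∞ := by finiteness
  refine le_antisymm (ENNReal.le_of_forall_pos_le_add fun ε hε _ => ?_) zero_le
  rw [zero_add]
  have hε' : μ N < (ε : ℝ≥0∞) / ((k : ℝ≥0∞) + 1) := by
    rw [hN]; exact ENNReal.div_pos (by simpa using hε.ne') hkt
  obtain ⟨U, hNU, hU, hμU⟩ := exists_isOpen_lt_of_lt N _ hε'
  have hopen : IsOpen (U⁻¹ ∩ W k) := hU.inv.inter (hW k)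
  calc μ (N⁻¹ ∩ W k) ≤ μ (U⁻¹ ∩ W k) :=
        measure_mono (inter_subset_inter_left _ (Set.inv_subset_inv.2 hNU))
    _ ≤ ε := by
        rw [hopen.measure_eq_iSup_isCompact]
        refine iSup₂_le fun C hC => iSup_le fun hCc => ?_
        have hcl : IsCompact (closure C⁻¹) := hCc.inv.closure
        have h1 : modularMeasure μ C ≤ μ U := by
          have := modularMeasure_inv_apply μ hcl
          rw [inv_inv] at this
          rw [this]
          refine measure_mono ?_
          rw [← Set.inv_subset_inv, inv_inv]
          exact hC.trans inter_subset_left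
        have h2 : ((k : ℝ≥0∞) + 1)⁻¹ * μ C ≤ modularMeasure μ C := by
          have hmeas : ∀ x ∈ C, ((k : ℝ≥0∞) + 1)⁻¹ ≤ (modularCharacter x : ℝ≥0∞) := by
            intro x hx
            have : ((k : ℝ≥0) + 1)⁻¹ < modularCharacter x := (hC hx).2
            have h3 : ((k : ℝ≥0∞) + 1)⁻¹ = (((k : ℝ≥0) + 1)⁻¹ : ℝ≥0) := by
              rw [ENNReal.coe_inv (by positivity)]; simp
            rw [h3]
            exact_mod_cast this.le
          calc ((k : ℝ≥0∞) + 1)⁻¹ * μ C = ∫⁻ _ in C, ((k : ℝ≥0∞) + 1)⁻¹ ∂μ := by simp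
            _ ≤ ∫⁻ x in C, modularCharacter x ∂μ :=
              setLIntegral_mono hmod.measurable.coe_nnreal_ennreal hmeas
            _ ≤ modularMeasure μ C := withDensity_apply_le _ _
        have h3 : μ C ≤ ((k : ℝ≥0∞) + 1) * μ U := by
          have := mul_le_mul_right (h2.trans h1) ((k : ℝ≥0∞) + 1)
          rwa [← mul_assoc, ENNReal.mul_inv_cancel hk0 hkt, one_mul] at this
        calc μ C ≤ ((k : ℝ≥0∞) + 1) * μ U := h3
          _ ≤ ((k : ℝ≥0∞) + 1) * (ε / ((k : ℝ≥0∞) + 1)) := by gcongr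
          _ = ε := ENNReal.mul_div_cancel hk0 hkt

lemma quasiMeasurePreserving_inv_of_regular : QuasiMeasurePreserving (fun x : X => x⁻¹) μ μ :=
  ⟨measurable_inv, AbsolutelyContinuous.mk fun s hs h => by
    rw [map_apply measurable_inv hs]; exact measure_inv_null_of_null μ h⟩

lemma quasiMeasurePreserving_inv_mul_of_regular (x : X) :
    QuasiMeasurePreserving (fun y : X => y⁻¹ * x) μ μ := by
  have h1 : QuasiMeasurePreserving (fun y : X => x⁻¹ * y) μ μ :=
    (measurePreserving_mul_left μ x⁻¹).quasiMeasurePreserving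
  have h2 := (quasiMeasurePreserving_inv_of_regular μ).comp h1
  have h3 : (fun y : X => y⁻¹ * x) = (fun y => y⁻¹) ∘ fun y => x⁻¹ * y := by
    funext y; simp
  rwa [h3]

variable {μ} in
lemma exists_isCompact_seq_ae_eq_zero {E : Type*} [NormedAddCommGroup E] {f : X → E}
    (hf : Integrable f μ) : ∃ K : ℕ → Set X, (∀ n, IsCompact (K n)) ∧
      ∀ᵐ x ∂μ, x ∉ ⋃ n, K n → f x = 0 := by
  obtain ⟨f', hf', hff'⟩ := hf.1
  have hfi : Integrable f' μ := hf.congr hff'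
  let A : ℕ → Set X := fun n => {x | ((n : ℝ) + 1)⁻¹ ≤ ‖f' x‖}
  have hA : ∀ n, MeasurableSet (A n) := fun n =>
    measurableSet_le measurable_const hf'.norm.measurable
  have hAfin : ∀ n, μ (A n) ≠ ∞ := fun n =>
    (hfi.measure_norm_ge_lt_top (by positivity)).ne
  have hex : ∀ n m : ℕ, ∃ K ⊆ A n, IsCompact K ∧ μ (A n \ K) < ((m : ℝ≥0∞) + 1)⁻¹ := fun n m =>
    (hA n).exists_isCompact_sdiff_lt (hAfin n) (by simp)
  choose K hKA hKc hKμ using hex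
  refine ⟨fun i => K i.unpair.1 i.unpair.2, fun i => hKc _ _, ?_⟩
  have hnull : ∀ n, μ (A n \ ⋃ m, K n m) = 0 := by
    intro n
    refine le_antisymm (ge_of_tendsto' ENNReal.tendsto_inv_nat_nhds_zero fun m => ?_) zero_le
    calc μ (A n \ ⋃ m, K n m) ≤ μ (A n \ K n m) := by gcongr; exact subset_iUnion _ _
      _ ≤ ((m : ℝ≥0∞) + 1)⁻¹ := (hKμ n m).le
      _ ≤ (m : ℝ≥0∞)⁻¹ := by gcongr; exact le_self_add
  have hall : ∀ᵐ x ∂μ, ∀ n, x ∉ A n \ ⋃ m, K n m :=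
    ae_all_iff.2 fun n => measure_eq_zero_iff_ae_notMem.1 (hnull n)
  filter_upwards [hall, hff'] with x hx hfx hxK
  by_contra hne
  rw [hfx] at hne
  obtain ⟨n, hn⟩ := exists_nat_one_div_lt (norm_pos_iff.2 hne)
  have hxA : x ∈ A n := by
    have : ((n : ℝ) + 1)⁻¹ ≤ ‖f' x‖ := by simpa [one_div] using hn.le
    exact this
  refine hx n ⟨hxA, fun hxm => hxK ?_⟩
  obtain ⟨m, hm⟩ := mem_iUnion.1 hxm
  exact mem_iUnion.2 ⟨Nat.pair n m, by simpa using hm⟩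

variable {μ} in
/-- An integrable function vanishes almost everywhere outside an open subgroup which is the union
of an increasing sequence of compact sets. -/
lemma exists_subgroup_ae_eq_zero {E : Type*} [NormedAddCommGroup E] {f : X → E}
    (hf : Integrable f μ) : ∃ (G : Subgroup X) (T : ℕ → Set X), IsOpen (G : Set X) ∧ Monotone T ∧
      (∀ n, IsCompact (T n)) ∧ ⋃ n, T n = G ∧ ∀ᵐ x ∂μ, x ∉ G → f x = 0 := by
  obtain ⟨K, hK, hfK⟩ := exists_isCompact_seq_ae_eq_zero hf
  obtain ⟨V, hVc, hV⟩ := exists_compact_mem_nhds (1 : X)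
  -- symmetric compact sets whose powers exhaust the subgroup generated by `V` and all the `K i`
  let C : ℕ → Set X := fun n =>
    (V ∪ V⁻¹) ∪ ⋃ i ∈ Finset.range n, (K i ∪ (K i)⁻¹)
  have hCc : ∀ n, IsCompact (C n) := fun n =>
    (hVc.union hVc.inv).union ((Finset.range n).isCompact_biUnion fun i _ =>
      (hK i).union (hK i).inv)
  have hCm : Monotone C := fun m n h => union_subset_union_right _
    (biUnion_subset_biUnion_left fun i hi => Finset.range_mono h hi)
  have hC1 : ∀ n, (1 : X) ∈ C n := fun n => Or.inl (Or.inl (mem_of_mem_nhds hV))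
  have hCi : ∀ n, (C n)⁻¹ = C n := by
    intro n
    simp only [C, Set.union_inv, Set.iUnion_inv, inv_inv]
    congr 1
    · exact union_comm _ _
    · simp only [union_comm]
  have hpow : ∀ {m n k l : ℕ}, m ≤ n → k ≤ l → (C m) ^ k ⊆ (C n) ^ l := fun hmn hkl =>
    (Set.pow_subset_pow_left (hCm hmn)).trans (Set.pow_subset_pow_right (hC1 _) hkl)
  let G : Subgroup X :=
    { carrier := ⋃ n, (C n) ^ n
      one_mem' := mem_iUnion.2 ⟨0, by simp⟩
      mul_mem' := by
        intro a b ha hb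
        obtain ⟨m, hm⟩ := mem_iUnion.1 ha
        obtain ⟨n, hn⟩ := mem_iUnion.1 hb
        refine mem_iUnion.2 ⟨m + n, ?_⟩
        rw [pow_add]
        exact Set.mul_mem_mul (hpow (Nat.le_add_right m n) le_rfl hm)
          (hpow (Nat.le_add_left n m) le_rfl hn)
      inv_mem' := by
        intro a ha
        obtain ⟨m, hm⟩ := mem_iUnion.1 ha
        refine mem_iUnion.2 ⟨m, ?_⟩
        rwa [← hCi m, inv_pow, Set.inv_mem_inv] }
  have hCpow : ∀ n k, IsCompact ((C n) ^ k) := by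
    intro n k
    induction k with
    | zero => simp
    | succ k ih => rw [pow_succ]; exact ih.mul (hCc n)
  have hCG : ∀ n, C n ⊆ G := by
    intro n x hx
    refine mem_iUnion.2 ⟨n + 1, ?_⟩
    have : x ∈ (C n) ^ 1 := by rwa [pow_one]
    exact hpow (Nat.le_succ n) (Nat.le_add_left 1 n) this
  refine ⟨G, fun n => (C n) ^ n, ?_, fun m n h => hpow h h, fun n => hCpow n n, rfl, ?_⟩
  · exact G.isOpen_of_mem_nhds (g := 1) (mem_of_superset hV fun x hx => hCG 0 (Or.inl (Or.inl hx)))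
  · filter_upwards [hfK] with x hx hxG
    refine hx fun hxK => hxG ?_
    obtain ⟨n, hn⟩ := mem_iUnion.1 hxK
    exact hCG (n + 1) (Or.inr (mem_iUnion₂.2 ⟨n, Finset.self_mem_range_succ n, Or.inl hn⟩))

variable {μ} in
/-- The image of `Δ(x)⁻¹ dx` under inversion is `dx`, on integrable functions. -/
lemma integrable_modularCharacter_smul_inv {E : Type*} [NormedAddCommGroup E] [NormedSpace ℝ E]
    {f : X → E} (hf : Integrable f μ) :
    Integrable (fun x => (modularCharacter x : ℝ) • f x⁻¹) μ ∧
      ∫ x, (modularCharacter x : ℝ) • f x⁻¹ ∂μ = ∫ x, f x ∂μ := by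
  obtain ⟨G, T, hG, hTm, hTc, hT, hfG⟩ := exists_subgroup_ae_eq_zero hf
  have hmod := (continuous_modularCharacter (X := X)).measurable
  -- both measures agree on subsets of the compact sets `T n`, hence on all of `G`
  have hmeas : (map (fun x : X => x⁻¹) ((modularMeasure μ).restrict G)) = μ.restrict G := by
    ext s hs
    have hs' : MeasurableSet ((fun x : X => x⁻¹) ⁻¹' s) := measurable_inv hs
    have hTm' : Monotone fun n => s ∩ T n := fun m n h => inter_subset_inter_right _ (hTm h)
    have hGs : (fun x : X => x⁻¹) ⁻¹' s ∩ G = ⋃ n, (s ∩ T n)⁻¹ := by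
      rw [← Set.iUnion_inv, ← inter_iUnion, hT, Set.inter_inv]
      congr 1
      ext x; simp
    have hGs' : s ∩ G = ⋃ n, (s ∩ T n) := by rw [← inter_iUnion, hT]
    have hTi : Monotone fun n => (s ∩ T n)⁻¹ := fun m n h => Set.inv_subset_inv.2 (hTm' h)
    rw [map_apply measurable_inv hs, restrict_apply hs, restrict_apply hs', hGs, hGs',
      hTi.measure_iUnion, hTm'.measure_iUnion]
    refine iSup_congr fun n => modularMeasure_inv_apply μ ?_
    exact (hTc n).closure_of_subset inter_subset_right
  have hfG' : Integrable f (μ.restrict G) := hf.mono_measure restrict_le_self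
  have hGm : MeasurableSet (G : Set X) := hG.measurableSet
  have hGi : ∀ᵐ x ∂μ, x ∉ (G : Set X) → (modularCharacter x : ℝ) • f x⁻¹ = 0 := by
    filter_upwards [(quasiMeasurePreserving_inv_of_regular μ).ae hfG] with x hx hxG
    rw [hx (by simpa using hxG), smul_zero]
  have hset : modularMeasure μ = μ.withDensity fun x => (modularCharacter x : ℝ≥0∞) := rfl
  rw [← hmeas, hset, restrict_withDensity hGm] at hfG'
  have h1 := (integrable_map_measure hfG'.1 measurable_inv.aemeasurable).1 hfG'
  rw [integrable_withDensity_iff_integrable_smul hmod] at h1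
  have h2 : IntegrableOn (fun x => (modularCharacter x : ℝ) • f x⁻¹) G μ := h1
  constructor
  · exact h2.integrable_of_ae_notMem_eq_zero hGi
  · rw [← setIntegral_eq_integral_of_ae_compl_eq_zero hGi,
      ← setIntegral_eq_integral_of_ae_compl_eq_zero hfG]
    have h3 : ∫ x in G, f x ∂μ =
        ∫ x, f x ∂(map (fun x : X => x⁻¹) ((modularMeasure μ).restrict G)) := by rw [hmeas]
    rw [h3, hset, restrict_withDensity hGm, integral_map measurable_inv.aemeasurable hfG'.1,
      integral_withDensity_eq_integral_smul hmod]
    rfl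

end GroupMeasure

/-! ### Fubini's theorem for the shear -/

section Shear

open Measure Set Filter ProbabilityTheory
open scoped NNReal Pointwise

variable {X : Type*} [Group X] [TopologicalSpace X] [IsTopologicalGroup X] [LocallyCompactSpace X]
  [T2Space X] [MeasurableSpace X] [BorelSpace X] (μ : Measure X) [μ.IsHaarMeasure] [μ.Regular]

set_option linter.unusedSectionVars false

lemma measurable_shear (x : X) : Measurable fun y : X => (y, y⁻¹ * x) :=
  measurable_id.prodMk (measurable_inv.mul_const x)

/-- The image of `dy` on `D` under `y ↦ (y, y⁻¹ x)`. -/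
def shearMeasure (D : Set X) (x : X) : Measure (X × X) :=
  (μ.restrict D).map fun y => (y, y⁻¹ * x)

lemma shearMeasure_apply {D : Set X} (x : X) {N : Set (X × X)} (hN : MeasurableSet N) :
    shearMeasure μ D x N = μ ({y | (y, y⁻¹ * x) ∈ N} ∩ D) := by
  rw [shearMeasure, map_apply (measurable_shear x) hN, restrict_apply (measurable_shear x hN)]
  rfl

/-- For `B` open the function is lower semicontinuous, by inner regularity of `μ`. -/
lemma measurable_measure_inter_shear {D : Set X} (hD : MeasurableSet D) (hDf : μ D ≠ ∞)
    {B : Set X} (hB : IsOpen B) : Measurable fun x => μ ({y | y⁻¹ * x ∈ B} ∩ D) := by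
  refine LowerSemicontinuous.measurable fun x t ht => ?_
  have hmeas : MeasurableSet ({y | y⁻¹ * x ∈ B} ∩ D) :=
    (hB.preimage (by fun_prop : Continuous fun y : X => y⁻¹ * x)).measurableSet.inter hD
  have hfin : μ ({y | y⁻¹ * x ∈ B} ∩ D) ≠ ∞ := measure_ne_top_of_subset inter_subset_right hDf
  obtain ⟨C, hC, hCc, htC⟩ := hmeas.exists_lt_isCompact_of_ne_top hfin ht
  have hopen : IsOpen {x' : X | ∀ y ∈ C, y⁻¹ * x' ∈ B} := by
    have hset : {x' : X | ∀ y ∈ C, y⁻¹ * x' ∈ B} =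
        {x' : X | ∀ y ∈ C, (x', y) ∈ (fun p : X × X => p.2⁻¹ * p.1) ⁻¹' B} := rfl
    rw [hset, isOpen_iff_mem_nhds]
    intro x₀ hx₀
    obtain ⟨U, V, hU, -, hxU, hCV, hUV⟩ := generalized_tube_lemma (isCompact_singleton (x := x₀)) hCc
      (hB.preimage (by fun_prop : Continuous fun p : X × X => p.2⁻¹ * p.1))
      (by rintro ⟨a, b⟩ ⟨rfl, hb⟩; exact hx₀ b hb)
    exact mem_of_superset (hU.mem_nhds (hxU rfl)) fun a ha b hb => hUV ⟨ha, hCV hb⟩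
  filter_upwards [hopen.mem_nhds (show x ∈ {x' : X | ∀ y ∈ C, y⁻¹ * x' ∈ B} from
    fun y hy => (hC hy).1)] with x' hx'
  exact htC.trans_le (measure_mono fun y hy => ⟨hx' y hy, (hC hy).2⟩)

lemma measurable_shearMeasure_of_ne_top {D : Set X} (hD : MeasurableSet D) (hDf : μ D ≠ ∞) :
    Measurable (shearMeasure μ D) := by
  have : Fact (μ D < ∞) := ⟨hDf.lt_top⟩
  have hfin : ∀ x, IsFiniteMeasure (shearMeasure μ D x) := fun x => by
    unfold shearMeasure; infer_instance
  have hgen : (Prod.instMeasurableSpace : MeasurableSpace (X × X)) =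
      .generateFrom (image2 (· ×ˢ ·) {s : Set X | IsOpen s} {t : Set X | IsOpen t}) := by
    have hs : IsCountablySpanning {s : Set X | IsOpen s} :=
      ⟨fun _ => univ, fun _ => isOpen_univ, iUnion_const _⟩
    have h := generateFrom_prod_eq hs hs
    rw [← borel, ← BorelSpace.measurable_eq (α := X)] at h
    exact h
  refine Measurable.measure_of_isPiSystem hgen (isPiSystem_isOpen.prod isPiSystem_isOpen) ?_ ?_
  · rintro _ ⟨A, hA, B, hB, rfl⟩
    have h := measurable_measure_inter_shear μ (hD.inter (IsOpen.measurableSet hA))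
      (measure_ne_top_of_subset inter_subset_left hDf) hB
    have heq : (fun x => shearMeasure μ D x (A ×ˢ B)) =
        fun x => μ ({y | y⁻¹ * x ∈ B} ∩ (D ∩ A)) := by
      funext x
      rw [shearMeasure_apply _ _ ((IsOpen.measurableSet hA).prod (IsOpen.measurableSet hB))]
      congr 1
      ext y
      simp only [mem_prod, mem_inter_iff, mem_ofPred_eq]
      tauto
    rw [heq]
    exact h
  · have : (fun x => shearMeasure μ D x univ) = fun _ => μ D := by
      funext x; rw [shearMeasure_apply _ _ MeasurableSet.univ]; simp
    rw [this]; exact measurable_const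

/-- Tonelli's theorem for the shear, for continuous functions with compact support. -/
lemma lintegral_lintegral_inv_mul_of_hasCompactSupport {D : Set X} (hD : MeasurableSet D)
    {K : Set X} (hK : IsCompact K) (hDK : D ⊆ K) {g : X → ℝ} (hg : Continuous g)
    (hgc : HasCompactSupport g) (hg0 : 0 ≤ g) :
    ∫⁻ x, ∫⁻ y in D, ENNReal.ofReal (g (y⁻¹ * x)) ∂μ ∂μ = μ D * ∫⁻ x, ENNReal.ofReal (g x) ∂μ := by
  have hDf : μ D < ∞ := (measure_mono hDK).trans_lt hK.measure_lt_top
  have : Fact (μ D < ∞) := ⟨hDf⟩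
  obtain ⟨u, hu1, hu0, huc, -⟩ := exists_continuous_one_zero_of_isCompact hK isClosed_empty (disjoint_empty K)
  have hinner : ∀ x, Integrable (fun y => g (y⁻¹ * x)) (μ.restrict D) := by
    intro x
    have hc : Continuous fun y : X => g (y⁻¹ * x) := by fun_prop
    have hcc : HasCompactSupport fun y : X => g (y⁻¹ * x) :=
      hgc.comp_homeomorph ((Homeomorph.inv X).trans (Homeomorph.mulRight x))
    exact (hc.integrable_of_hasCompactSupport hcc)
  have hcont : Continuous fun x => ∫ y in D, g (y⁻¹ * x) ∂μ :=
    continuous_integral_apply_inv_mul hg hgc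
  have hcomp : HasCompactSupport fun x => ∫ y in D, g (y⁻¹ * x) ∂μ := by
    refine HasCompactSupport.intro (hK.mul hgc.isCompact) fun x hx => ?_
    refine setIntegral_eq_zero_of_forall_eq_zero fun y hy => ?_
    by_contra hne
    refine hx ⟨y, hDK hy, y⁻¹ * x, subset_tsupport _ hne, by simp⟩
  have hswap : ∫ x, ∫ y in D, u y * g (y⁻¹ * x) ∂μ ∂μ = ∫ y in D, ∫ x, u y * g (y⁻¹ * x) ∂μ ∂μ := by
    refine integral_integral_swap_of_hasCompactSupport (f := fun x y => u y * g (y⁻¹ * x)) ?_ ?_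
    · have := u.continuous
      change Continuous fun p : X × X => u p.2 * g (p.2⁻¹ * p.1)
      fun_prop
    · refine HasCompactSupport.intro ((huc.isCompact.mul hgc.isCompact).prod huc.isCompact) ?_
      rintro ⟨x, y⟩ hxy
      by_contra hne
      have h1 : u y ≠ 0 := left_ne_zero_of_mul hne
      have h2 : g (y⁻¹ * x) ≠ 0 := right_ne_zero_of_mul hne
      exact hxy ⟨⟨y, subset_tsupport _ h1, y⁻¹ * x, subset_tsupport _ h2, by simp⟩,
        subset_tsupport _ h1⟩
  have hu : ∀ x, ∫ y in D, u y * g (y⁻¹ * x) ∂μ = ∫ y in D, g (y⁻¹ * x) ∂μ := fun x =>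
    setIntegral_congr_fun hD fun y hy => by simp [hu1 (hDK hy)]
  have hv : ∫ y in D, ∫ x, u y * g (y⁻¹ * x) ∂μ ∂μ = μ.real D * ∫ x, g x ∂μ := by
    rw [setIntegral_congr_fun (g := fun _ => ∫ x, g x ∂μ) hD]
    · simp
    · intro y hy
      simp [hu1 (hDK hy), integral_mul_left_eq_self g y⁻¹]
  simp only [hu] at hswap
  rw [hv] at hswap
  have hg' := hg.integrable_of_hasCompactSupport hgc (μ := μ)
  have h1 : ∀ x, ∫⁻ y in D, ENNReal.ofReal (g (y⁻¹ * x)) ∂μ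
      = ENNReal.ofReal (∫ y in D, g (y⁻¹ * x) ∂μ) := fun x =>
    (ofReal_integral_eq_lintegral_ofReal (hinner x) (Eventually.of_forall fun y => hg0 (y⁻¹ * x))).symm
  simp only [h1]
  rw [← ofReal_integral_eq_lintegral_ofReal (hcont.integrable_of_hasCompactSupport hcomp)
    (Eventually.of_forall fun x => integral_nonneg fun y => hg0 (y⁻¹ * x)), hswap,
    ← ofReal_integral_eq_lintegral_ofReal hg' (Eventually.of_forall hg0),
    ENNReal.ofReal_mul measureReal_nonneg, ofReal_measureReal hDf.ne]

/-- The measure `B ↦ ∫ μ(D ∩ x B⁻¹) dx`. -/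
def convMeasure (D : Set X) : Measure X := (μ.bind (shearMeasure μ D)).map Prod.snd

lemma convMeasure_apply {D : Set X} (hD : MeasurableSet D) (hDf : μ D ≠ ∞) {B : Set X}
    (hB : MeasurableSet B) : convMeasure μ D B = ∫⁻ x, μ ({y | y⁻¹ * x ∈ B} ∩ D) ∂μ := by
  rw [convMeasure, map_apply measurable_snd hB, bind_apply (measurable_snd hB)
    (measurable_shearMeasure_of_ne_top μ hD hDf).aemeasurable]
  refine lintegral_congr fun x => ?_
  rw [shearMeasure_apply _ _ (measurable_snd hB)]
  rfl

lemma lintegral_convMeasure {D : Set X} (hD : MeasurableSet D) (hDf : μ D ≠ ∞) {g : X → ℝ≥0∞}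
    (hg : Measurable g) : ∫⁻ z, g z ∂(convMeasure μ D) = ∫⁻ x, ∫⁻ y in D, g (y⁻¹ * x) ∂μ ∂μ := by
  rw [convMeasure, lintegral_map hg measurable_snd, lintegral_bind
    (measurable_shearMeasure_of_ne_top μ hD hDf).aemeasurable
    (f := fun p : X × X => g p.2) (hg.comp measurable_snd).aemeasurable]
  refine lintegral_congr fun x => ?_
  rw [shearMeasure, lintegral_map (f := fun p : X × X => g p.2) (hg.comp measurable_snd)
    (measurable_shear x)]

omit [IsTopologicalGroup X] [LocallyCompactSpace X] [T2Space X] [μ.IsHaarMeasure] [Group X] in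
variable {μ} in
lemma le_mul_measure_of_forall_isOpen {a c : ℝ≥0∞} (ha : a ≠ ∞) {S : Set X} (hS : μ S ≠ ∞)
    (h : ∀ U, S ⊆ U → IsOpen U → μ U ≠ ∞ → c ≤ a * μ U) : c ≤ a * μ S := by
  have hlim : Tendsto (fun n : ℕ => a * (μ S + (n : ℝ≥0∞)⁻¹)) atTop (𝓝 (a * (μ S + 0))) :=
    ENNReal.Tendsto.const_mul (tendsto_const_nhds.add ENNReal.tendsto_inv_nat_nhds_zero)
      (Or.inr ha)
  rw [add_zero] at hlim
  refine ge_of_tendsto' hlim fun n => ?_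
  obtain ⟨U, hSU, hU, hμU⟩ := exists_isOpen_lt_add S hS
    (show (n : ℝ≥0∞)⁻¹ ≠ 0 by simp)
  exact (h U hSU hU hμU.ne_top).trans (by gcongr)

/-- One half of `∫ μ(D ∩ x B⁻¹) dx = μ(D) μ(B)`: for compact `B` by comparison with continuous
functions, for open `B` by exhaustion with compact sets, in general by outer regularity. -/
lemma convMeasure_le {D K B : Set X} (hD : MeasurableSet D) (hK : IsCompact K) (hDK : D ⊆ K)
    (hBf : μ B ≠ ∞) : convMeasure μ D B ≤ μ D * μ B := by
  have hDf : μ D ≠ ∞ := ((measure_mono hDK).trans_lt hK.measure_lt_top).ne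
  have hac : ∀ {N : Set X}, MeasurableSet N → μ N = 0 → convMeasure μ D N = 0 := by
    intro N hNm hN
    rw [convMeasure_apply μ hD hDf hNm]
    refine lintegral_eq_zero_of_ae_eq_zero (Eventually.of_forall fun x => ?_)
    exact measure_mono_null inter_subset_left
      ((quasiMeasurePreserving_inv_mul_of_regular μ x).preimage_null hN)
  have hcompact : ∀ {L : Set X}, IsCompact L → convMeasure μ D L ≤ μ D * μ L := by
    intro L hL
    refine le_mul_measure_of_forall_isOpen hDf hL.measure_lt_top.ne fun U hLU hU _ => ?_
    obtain ⟨g, hg1, hg0, hgc, hg⟩ := exists_continuous_one_zero_of_isCompact hL hU.isClosed_compl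
      (disjoint_compl_right_iff_subset.2 hLU)
    have hgm : Measurable fun x => ENNReal.ofReal (g x) :=
      ENNReal.measurable_ofReal.comp g.continuous.measurable
    calc convMeasure μ D L = ∫⁻ z in L, 1 ∂(convMeasure μ D) := by simp
      _ ≤ ∫⁻ z in L, ENNReal.ofReal (g z) ∂(convMeasure μ D) :=
        setLIntegral_mono hgm fun z hz => by simp [hg1 hz]
      _ ≤ ∫⁻ z, ENNReal.ofReal (g z) ∂(convMeasure μ D) := setLIntegral_le_lintegral _ _
      _ = μ D * ∫⁻ z, ENNReal.ofReal (g z) ∂μ := by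
        rw [lintegral_convMeasure μ hD hDf hgm,
          lintegral_lintegral_inv_mul_of_hasCompactSupport μ hD hK hDK g.continuous hgc
            fun x => (hg x).1]
      _ ≤ μ D * ∫⁻ z, U.indicator 1 z ∂μ := by
        gcongr with z
        by_cases hz : z ∈ U
        · simpa [hz] using (hg z).2
        · simp [hz, hg0 hz]
      _ = μ D * μ U := by rw [lintegral_indicator_one hU.measurableSet]
  have hopen : ∀ {V : Set X}, IsOpen V → μ V ≠ ∞ → convMeasure μ D V ≤ μ D * μ V := by
    intro V hV hVf
    have hex : ∀ n : ℕ, ∃ L ⊆ V, IsCompact L ∧ μ (V \ L) < ((n : ℝ≥0∞) + 1)⁻¹ := fun n =>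
      hV.measurableSet.exists_isCompact_sdiff_lt hVf (by simp)
    choose L hLV hL hLμ using hex
    have hnull : μ (V \ ⋃ n, L n) = 0 := by
      refine le_antisymm (ge_of_tendsto' ENNReal.tendsto_inv_nat_nhds_zero fun n => ?_) zero_le
      calc μ (V \ ⋃ m, L m) ≤ μ (V \ L n) := by gcongr; exact subset_iUnion _ _
        _ ≤ ((n : ℝ≥0∞) + 1)⁻¹ := (hLμ n).le
        _ ≤ (n : ℝ≥0∞)⁻¹ := by gcongr; exact le_self_add
    have hLm : MeasurableSet (⋃ n, L n) := .iUnion fun n => (hL n).measurableSet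
    calc convMeasure μ D V ≤ convMeasure μ D (⋃ n, L n) + convMeasure μ D (V \ ⋃ n, L n) := by
          refine (measure_mono ?_).trans (measure_union_le _ _)
          intro x hx; by_cases h : x ∈ ⋃ n, L n
          · exact Or.inl h
          · exact Or.inr ⟨hx, h⟩
      _ = ⨆ n, convMeasure μ D (accumulate L n) := by
        rw [hac (hV.measurableSet.diff hLm) hnull, add_zero, measure_iUnion_eq_iSup_accumulate]
      _ ≤ μ D * μ V := by
        refine iSup_le fun n => ?_
        have hacc : IsCompact (accumulate L n) := by
          rw [accumulate_def]
          exact (finite_Iic n).isCompact_biUnion fun i _ => hL i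
        refine (hcompact hacc).trans ?_
        gcongr
        exact iUnion₂_subset fun i _ => hLV i
  exact le_mul_measure_of_forall_isOpen hDf hBf fun U hBU hU hUf =>
    (measure_mono hBU).trans (hopen hU hUf)

/-- Equality follows from the inequality for `B` and for its complement, since a continuous function
that is `1` on `B` has the same integral for both measures. -/
lemma convMeasure_apply_of_subset_isCompact {D K B L : Set X} (hD : MeasurableSet D)
    (hK : IsCompact K) (hDK : D ⊆ K) (hB : MeasurableSet B) (hL : IsCompact L) (hBL : B ⊆ L) :
    convMeasure μ D B = μ D * μ B := by
  have hDf : μ D ≠ ∞ := ((measure_mono hDK).trans_lt hK.measure_lt_top).ne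
  have hBf : μ B ≠ ∞ := ((measure_mono hBL).trans_lt hL.measure_lt_top).ne
  refine le_antisymm (convMeasure_le μ hD hK hDK hBf) ?_
  obtain ⟨g, hg1, -, hgc, hg⟩ := exists_continuous_one_zero_of_isCompact hL isClosed_empty
    (disjoint_empty L)
  set S := tsupport g with hS
  have hSc : IsCompact S := hgc
  have hgm : Measurable fun x => ENNReal.ofReal (g x) :=
    ENNReal.measurable_ofReal.comp g.continuous.measurable
  -- `g = 1_B + h`
  let h : X → ℝ≥0∞ := Bᶜ.indicator fun x => ENNReal.ofReal (g x)
  have hh : Measurable h := hgm.indicator hB.compl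
  have hsum : ∀ x, ENNReal.ofReal (g x) = B.indicator 1 x + h x := by
    intro x
    by_cases hx : x ∈ B
    · simp [h, hx, hg1 (hBL hx)]
    · simp [h, hx]
  have hsupp : ∀ x, x ∉ S → h x = 0 := by
    intro x hx
    have : g x = 0 := image_eq_zero_of_notMem_tsupport hx
    simp [h, indicator, this]
  have hle : (convMeasure μ D).restrict S ≤ μ D • μ.restrict S := by
    refine Measure.le_iff.2 fun E hE => ?_
    rw [restrict_apply hE, Measure.smul_apply, restrict_apply hE]
    exact convMeasure_le μ hD hK hDK
      ((measure_mono inter_subset_right).trans_lt hSc.measure_lt_top).ne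
  have htot : μ D * ∫⁻ x, ENNReal.ofReal (g x) ∂μ = ∫⁻ x, ENNReal.ofReal (g x) ∂(convMeasure μ D) := by
    rw [lintegral_convMeasure μ hD hDf hgm,
      lintegral_lintegral_inv_mul_of_hasCompactSupport μ hD hK hDK g.continuous hgc fun x => (hg x).1]
  simp only [hsum] at htot
  rw [lintegral_add_right _ hh, lintegral_add_right _ hh, lintegral_indicator_one hB,
    lintegral_indicator_one hB, mul_add] at htot
  have hhle : ∫⁻ x, h x ∂(convMeasure μ D) ≤ μ D * ∫⁻ x, h x ∂μ := by
    calc ∫⁻ x, h x ∂(convMeasure μ D) = ∫⁻ x in S, h x ∂(convMeasure μ D) :=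
          (setLIntegral_eq_of_support_subset
            (Function.support_subset_iff'.2 fun x hx => hsupp x hx)).symm
      _ ≤ ∫⁻ x, h x ∂(μ D • μ.restrict S) := lintegral_mono' hle le_rfl
      _ = μ D * ∫⁻ x in S, h x ∂μ := by rw [lintegral_smul_measure, smul_eq_mul]
      _ ≤ μ D * ∫⁻ x, h x ∂μ := by gcongr; exact restrict_le_self
  have hfin : μ D * ∫⁻ x, h x ∂μ ≠ ∞ := by
    refine ENNReal.mul_ne_top hDf (ne_top_of_le_ne_top hSc.measure_lt_top.ne (b := μ S) ?_)
    calc ∫⁻ x, h x ∂μ ≤ ∫⁻ x, S.indicator 1 x ∂μ := by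
          refine lintegral_mono fun x => ?_
          by_cases hx : x ∈ S
          · simp only [hx, indicator_of_mem, Pi.one_apply]
            exact (indicator_le_self _ _ x).trans (by simpa using (hg x).2)
          · simp [hsupp x hx]
      _ = μ S := lintegral_indicator_one hSc.measurableSet
  refine (ENNReal.add_le_add_iff_right hfin).1 ?_
  rw [htot]
  gcongr

variable {G : Subgroup X} {T : ℕ → Set X}

lemma shearMeasure_apply_eq_iSup (hTm : Monotone T) (hT : ⋃ n, T n = G) (x : X) {N : Set (X × X)}
    (hN : MeasurableSet N) : shearMeasure μ G x N = ⨆ n, shearMeasure μ (T n) x N := by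
  have hm : Monotone fun n => {y | (y, y⁻¹ * x) ∈ N} ∩ T n :=
    fun m n h => inter_subset_inter_right _ (hTm h)
  simp only [shearMeasure_apply μ x hN]
  rw [← hT, inter_iUnion, hm.measure_iUnion]

lemma measurable_shearMeasure (hTm : Monotone T) (hTc : ∀ n, IsCompact (T n))
    (hT : ⋃ n, T n = G) : Measurable (shearMeasure μ (G : Set X)) := by
  refine measurable_of_measurable_coe _ fun N hN => ?_
  simp only [shearMeasure_apply_eq_iSup μ hTm hT _ hN]
  exact .iSup fun n => measurable_measure.1 (measurable_shearMeasure_of_ne_top μ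
    (hTc n).measurableSet (hTc n).measure_lt_top.ne) N hN

lemma sigmaFinite_restrict_of_iUnion (hTc : ∀ n, IsCompact (T n)) (hT : ⋃ n, T n = G) :
    SigmaFinite (μ.restrict (G : Set X)) := by
  have hGm : MeasurableSet (G : Set X) := hT ▸ .iUnion fun n => (hTc n).measurableSet
  refine ⟨⟨⟨fun n => T n ∪ (G : Set X)ᶜ, fun _ => trivial, fun n => ?_, ?_⟩⟩⟩
  · rw [restrict_apply' hGm]
    refine (measure_mono (t := T n) ?_).trans_lt (hTc n).measure_lt_top
    rintro x ⟨hx | hx, hxG⟩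
    · exact hx
    · exact absurd hxG hx
  · rw [← iUnion_union, hT, union_compl_self]

/-- The shear `(x, y) ↦ (y, y⁻¹ x)` maps `dx dy` to the product measure, in the sense of
disintegrations. -/
lemma bind_shearMeasure (hG : IsOpen (G : Set X)) (hTm : Monotone T) (hTc : ∀ n, IsCompact (T n))
    (hT : ⋃ n, T n = G) : (μ.restrict (G : Set X)).bind (shearMeasure μ G) =
      (μ.restrict (G : Set X)).prod (μ.restrict (G : Set X)) := by
  have := sigmaFinite_restrict_of_iUnion μ hTc hT
  have hGm : MeasurableSet (G : Set X) := hG.measurableSet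
  refine (Measure.prod_eq fun A B hA hB => ?_).symm
  have hAB := hA.prod hB
  rw [bind_apply hAB (measurable_shearMeasure μ hTm hTc hT).aemeasurable]
  simp only [shearMeasure_apply_eq_iSup μ hTm hT _ hAB]
  have hmono : ∀ x, Monotone fun n => shearMeasure μ (T n) x (A ×ˢ B) := by
    intro x m n h
    simp only [shearMeasure_apply μ x hAB]
    exact measure_mono (inter_subset_inter_right _ (hTm h))
  have hmeas : ∀ n, Measurable fun x => shearMeasure μ (T n) x (A ×ˢ B) := fun n =>
    measurable_measure.1 (measurable_shearMeasure_of_ne_top μ (hTc n).measurableSet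
      (hTc n).measure_lt_top.ne) _ hAB
  rw [lintegral_iSup hmeas fun m n h x => hmono x h]
  have hn : ∀ n, ∫⁻ x in G, shearMeasure μ (T n) x (A ×ˢ B) ∂μ = μ (A ∩ T n) * μ (B ∩ G) := by
    intro n
    have hD : MeasurableSet (A ∩ T n) := hA.inter (hTc n).measurableSet
    have hDT : A ∩ T n ⊆ T n := inter_subset_right
    have hDf : μ (A ∩ T n) ≠ ∞ := ((measure_mono hDT).trans_lt (hTc n).measure_lt_top).ne
    have hTG : T n ⊆ G := by rw [← hT]; exact subset_iUnion _ _
    have h1 : ∫⁻ x in G, shearMeasure μ (T n) x (A ×ˢ B) ∂μ = convMeasure μ (A ∩ T n) (B ∩ G) := by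
      rw [convMeasure_apply μ hD hDf (hB.inter hGm), ← lintegral_indicator hGm]
      refine lintegral_congr fun x => ?_
      by_cases hx : x ∈ (G : Set X)
      · rw [indicator_of_mem hx, shearMeasure_apply μ x hAB]
        congr 1
        ext y
        simp only [mem_prod, mem_inter_iff, mem_ofPred_eq]
        constructor
        · rintro ⟨⟨h1, h2⟩, h3⟩
          exact ⟨⟨h2, G.mul_mem (G.inv_mem (hTG h3)) hx⟩, h1, h3⟩
        · rintro ⟨⟨h2, -⟩, h1, h3⟩
          exact ⟨⟨h1, h2⟩, h3⟩
      · rw [indicator_of_notMem hx]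
        symm
        refine measure_mono_null (t := ∅) ?_ measure_empty
        rintro y ⟨⟨-, hy⟩, -, hyT⟩
        refine hx ?_
        have := G.mul_mem (hTG hyT) hy
        rwa [mul_inv_cancel_left] at this
    have hmB : Monotone fun m => B ∩ T m := fun m n h => inter_subset_inter_right _ (hTm h)
    rw [h1, ← hT, inter_iUnion, hmB.measure_iUnion, hmB.measure_iUnion, ENNReal.mul_iSup]
    exact iSup_congr fun m => convMeasure_apply_of_subset_isCompact μ hD (hTc n) hDT
      (hB.inter (hTc m).measurableSet) (hTc m) inter_subset_right
  have hmA : Monotone fun m => A ∩ T m := fun m n h => inter_subset_inter_right _ (hTm h)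
  simp only [hn]
  rw [restrict_apply hA, restrict_apply hB, ← ENNReal.iSup_mul, ← hmA.measure_iUnion,
    ← inter_iUnion, hT]

/-- Fubini's theorem for the change of variables `(x, y) ↦ (y, y⁻¹ x)`, which need not be
measurable for the product `σ`-algebra. -/
lemma integrable_integral_shear {E : Type*} [NormedAddCommGroup E] [NormedSpace ℝ E]
    (hG : IsOpen (G : Set X)) (hTm : Monotone T) (hTc : ∀ n, IsCompact (T n)) (hT : ⋃ n, T n = G)
    {F : X × X → E}
    (hF : Integrable F ((μ.restrict (G : Set X)).prod (μ.restrict (G : Set X)))) :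
    (∀ᵐ x ∂(μ.restrict (G : Set X)), IntegrableOn (fun y => F (y, y⁻¹ * x)) G μ) ∧
    IntegrableOn (fun x => ∫ y in G, F (y, y⁻¹ * x) ∂μ) G μ ∧
    ∫ x in G, ∫ y in G, F (y, y⁻¹ * x) ∂μ ∂μ =
      ∫ p, F p ∂((μ.restrict (G : Set X)).prod (μ.restrict (G : Set X))) := by
  rw [← bind_shearMeasure μ hG hTm hTc hT] at hF ⊢
  let κ : Kernel X (X × X) := ⟨shearMeasure μ (G : Set X), measurable_shearMeasure μ hTm hTc hT⟩
  have hF' : Integrable F ((μ.restrict (G : Set X)).bind κ) := hF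
  have hae := ae_integrable_of_integrable_comp hF'
  have hval : ∀ᵐ x ∂(μ.restrict (G : Set X)),
      ∫ p, F p ∂(κ x) = ∫ y in G, F (y, y⁻¹ * x) ∂μ := by
    filter_upwards [hae] with x hx
    exact integral_map (measurable_shear x).aemeasurable hx.1
  refine ⟨?_, ?_, ?_⟩
  · filter_upwards [hae] with x hx
    exact (integrable_map_measure hx.1 (measurable_shear x).aemeasurable).1 hx
  · refine Integrable.congr ?_ hval
    rw [Measure.comp_eq_comp_const_apply] at hF'
    exact hF'.integral_comp
  · rw [← integral_congr_ae hval]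
    change _ = ∫ p, F p ∂((μ.restrict (G : Set X)).bind κ)
    rw [Measure.comp_eq_comp_const_apply] at hF' ⊢
    rw [Kernel.integral_comp hF']
    simp

end Shear

/-! ### Central multipliers -/

section MultiplierCalculus

variable {A : Type*} [NonUnitalCStarAlgebra A]

lemma eq_of_forall_mul_left {a b : A} (h : ∀ c, c * a = c * b) : a = b := by
  rw [← sub_eq_zero, ← CStarRing.star_mul_self_eq_zero_iff, mul_sub, h, sub_self]

lemma fst_mul (m : 𝓜(ℂ, A)) (a b : A) : m.fst (a * b) = m.fst a * b :=
  eq_of_forall_mul_left fun c => by rw [← m.central, ← mul_assoc, ← mul_assoc, m.central]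

lemma autMultiplier_fst (α : A ≃⋆ₐ[ℂ] A) (m : 𝓜(ℂ, A)) (a : A) :
    (autMultiplier α m).fst a = α (m.fst (α.symm a)) := rfl

lemma autMultiplier_snd (α : A ≃⋆ₐ[ℂ] A) (m : 𝓜(ℂ, A)) (a : A) :
    (autMultiplier α m).snd a = α (m.snd (α.symm a)) := rfl

/-- A unitary multiplier `m` with `m a = a m` for all `a ∈ A`. -/
structure IsCentralUnitary (m : 𝓜(ℂ, A)) : Prop where
  unitary : m ∈ unitary 𝓜(ℂ, A)
  snd_eq : ∀ a, m.snd a = m.fst a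

namespace IsCentralUnitary

variable {m : 𝓜(ℂ, A)} (hm : IsCentralUnitary m)
include hm

lemma mul_fst (a b : A) : a * m.fst b = m.fst (a * b) := by
  rw [← m.central, hm.snd_eq, fst_mul]

lemma star_fst (a : A) : star (m.fst a) = (star m).fst (star a) := by
  rw [DoubleCentralizer.star_fst, star_star, hm.snd_eq]

lemma star_fst_fst (a : A) : (star m).fst (m.fst a) = a := by
  have h := congrArg (fun n : 𝓜(ℂ, A) => n.fst a) (Unitary.star_mul_self_of_mem hm.unitary)
  simpa using h

lemma fst_star_fst (a : A) : m.fst ((star m).fst a) = a := by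
  have h := congrArg (fun n : 𝓜(ℂ, A) => n.fst a) (Unitary.mul_star_self_of_mem hm.unitary)
  simpa using h

lemma isCentralUnitary_star : IsCentralUnitary (star m) where
  unitary := Unitary.star_mem hm.unitary
  snd_eq a := by
    rw [DoubleCentralizer.star_snd, DoubleCentralizer.star_fst, hm.snd_eq]

lemma norm_fst_apply (a : A) : ‖m.fst a‖ = ‖a‖ := by
  have h : star (m.fst a) * m.fst a = star a * a := by
    rw [hm.star_fst, hm.mul_fst, ← fst_mul, hm.fst_star_fst]
  have h2 : ‖m.fst a‖ * ‖m.fst a‖ = ‖a‖ * ‖a‖ := by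
    rw [← CStarRing.norm_star_mul_self, ← CStarRing.norm_star_mul_self, h]
  nlinarith [norm_nonneg a, norm_nonneg (m.fst a)]

lemma fst_comm {n : 𝓜(ℂ, A)} (hn : IsCentralUnitary n) (a : A) :
    m.fst (n.fst a) = n.fst (m.fst a) := by
  refine eq_of_forall_mul_left fun c => ?_
  rw [hm.mul_fst, fst_mul, hn.mul_fst, hn.mul_fst, hm.mul_fst, fst_mul, fst_mul, fst_mul]

end IsCentralUnitary

end MultiplierCalculus

section RightMultiplier

variable {X : Type*} [Group X] {A : Type*} [NonUnitalCStarAlgebra A] (σ : X →* (A ≃⋆ₐ[ℂ] A))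

lemma aut_mul_apply (x y : X) (a : A) : σ (x * y) a = σ x (σ y a) := by
  rw [map_mul]; rfl

lemma aut_one_apply (a : A) : σ 1 a = a := by
  rw [map_one]; rfl

lemma aut_apply_inv_apply (x : X) (a : A) : σ x (σ x⁻¹ a) = a := by
  rw [← aut_mul_apply, mul_inv_cancel, aut_one_apply]

lemma aut_inv_apply_apply (x : X) (a : A) : σ x⁻¹ (σ x a) = a := by
  rw [← aut_mul_apply, inv_mul_cancel, aut_one_apply]

lemma aut_symm_apply (x : X) (a : A) : (σ x).symm a = σ x⁻¹ a := by
  rw [StarAlgEquiv.symm_apply_eq, aut_apply_inv_apply]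

lemma norm_aut_apply (x : X) (a : A) : ‖σ x a‖ = ‖a‖ :=
  (NonUnitalStarAlgHom.isometry (F := A ≃⋆ₐ[ℂ] A) (σ x) (σ x).injective).norm_map_of_map_zero
    (map_zero (σ x)) a

variable [TopologicalSpace X] [MeasurableSpace X] {σ} {ζ : X → X → 𝓜(ℂ, A)}

/-- As `σ` is multiplicative, the right multiplier is central. -/
lemma IsRightMultiplier.isCentralUnitary (hζ : IsRightMultiplier σ ζ) (x y : X) :
    IsCentralUnitary (ζ x y) where
  unitary := hζ.unitary x y
  snd_eq a := by
    -- the twist relation says `ζ(x,y) a ζ(x,y)* = a`; multiply by `ζ(x,y)` from the right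
    have h := hζ.twist x y a
    rw [← aut_mul_apply] at h
    have h2 : (star (ζ x y)).snd ((ζ x y).fst a) = a := ((σ (x * y)).injective h).symm
    have h3 := congrArg (fun n : 𝓜(ℂ, A) => n.snd ((ζ x y).fst a))
      (Unitary.star_mul_self_of_mem (hζ.unitary x y))
    have h4 : (ζ x y).snd ((star (ζ x y)).snd ((ζ x y).fst a)) = (ζ x y).fst a := by
      simpa using h3
    rwa [h2] at h4

/-- The cocycle identity, applied to an element of `A`. -/
lemma IsRightMultiplier.cocycle_apply (hζ : IsRightMultiplier σ ζ) (x y z : X) (a : A) :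
    σ y⁻¹ ((ζ z x).fst (σ y a)) =
      (star (ζ (z * x) y)).fst ((ζ z (x * y)).fst ((ζ x y).fst a)) := by
  have h := congrArg (fun n : 𝓜(ℂ, A) => n.fst a) (hζ.cocycle x y z)
  simp only [autMultiplier_fst, aut_symm_apply, StarAlgEquiv.symm_symm] at h
  rw [h]
  simp

/-- The covariance of `ω`, with the two central unitaries collected on the left. -/
lemma IsAssociatedMultiplier.covariant_apply {ω : X → X → (A →L[ℂ] ℂ)}
    (hζ : IsAssociatedMultiplier σ ω ζ) (x y z : X) (a : A) :
    ω x y (σ z a) = ω (x * z) (y * z) ((ζ y z).fst ((star (ζ x z)).fst a)) := by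
  rw [hζ.covariant]
  have h1 := hζ.isRightMultiplier.isCentralUnitary x z
  congr 1
  change (star (ζ x z)).snd ((ζ y z).fst a) = _
  rw [h1.isCentralUnitary_star.snd_eq]
  exact h1.isCentralUnitary_star.fst_comm (hζ.isRightMultiplier.isCentralUnitary y z) a

end RightMultiplier

/-! ### The Hilbert space of a positive definite kernel -/

open scoped InnerProductSpace ComplexConjugate

section KernelSpace

/-- Positive definite kernels on a set `S`. -/
structure IsPosDefKernel {S : Type*} (k : S → S → ℂ) : Prop where
  conj_symm : ∀ s t, conj (k s t) = k t s
  re_nonneg : ∀ f : S →₀ ℂ, 0 ≤ (f.sum fun s z => f.sum fun t w => conj z * w * k s t).re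

variable {S : Type*} {k : S → S → ℂ}

/-- Finitely supported functions on `S` with the semi-inner product given by a kernel. -/
@[nolint unusedArguments]
def KernelPre (_ : IsPosDefKernel k) := S →₀ ℂ

variable (hk : IsPosDefKernel k)

instance : AddCommGroup (KernelPre hk) := inferInstanceAs (AddCommGroup (S →₀ ℂ))
instance : Module ℂ (KernelPre hk) := inferInstanceAs (Module ℂ (S →₀ ℂ))

/-- Finitely supported functions as elements of the semi-inner product space. -/
def toKernelPre : (S →₀ ℂ) ≃ₗ[ℂ] KernelPre hk := LinearEquiv.refl ℂ _

/-- The semi-inner product `⟨f, g⟩ = ∑ conj(f(s)) g(t) k(s, t)`. -/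
abbrev kernelPreCore : PreInnerProductSpace.Core ℂ (KernelPre hk) where
  inner f g := ((toKernelPre hk).symm f).sum fun s z =>
    ((toKernelPre hk).symm g).sum fun t w => conj z * w * k s t
  conj_inner_symm f g := by
    rw [Finsupp.sum_comm]
    simp only [map_finsuppSum, map_mul, hk.conj_symm, RCLike.conj_conj]
    congr! 4
    funext t w
    ring
  re_inner_nonneg f := hk.re_nonneg _
  add_left f g h := by
    rw [map_add, Finsupp.sum_add_index'] <;> simp [← Finsupp.sum_add, add_mul]
  smul_left f g c := by
    rw [map_smul, Finsupp.sum_smul_index] <;> simp [Finsupp.mul_sum, ← mul_assoc]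

instance : SeminormedAddCommGroup (KernelPre hk) :=
  InnerProductSpace.Core.toSeminormedAddCommGroup (c := kernelPreCore hk)
instance : InnerProductSpace ℂ (KernelPre hk) :=
  InnerProductSpace.ofCore (kernelPreCore hk)

lemma kernelPre_inner (f g : S →₀ ℂ) : ⟪toKernelPre hk f, toKernelPre hk g⟫_ℂ =
    f.sum fun s z => g.sum fun t w => conj z * w * k s t := rfl

/-- The Hilbert space of a positive definite kernel. -/
abbrev KernelSpace := UniformSpace.Completion (KernelPre hk)

/-- The canonical map of `S` into the Hilbert space of a kernel. -/
def kernelVec (s : S) : KernelSpace hk :=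
  ((toKernelPre hk (Finsupp.single s 1) : KernelPre hk) : KernelSpace hk)

lemma inner_kernelVec (s t : S) : ⟪kernelVec hk s, kernelVec hk t⟫_ℂ = k s t := by
  rw [kernelVec, kernelVec, UniformSpace.Completion.inner_coe, kernelPre_inner]
  simp

lemma kernelVec_dense : Dense (Submodule.span ℂ (Set.range (kernelVec hk)) : Set (KernelSpace hk)) := by
  refine UniformSpace.Completion.denseRange_coe.mono ?_
  rintro _ ⟨f, rfl⟩
  obtain ⟨f, rfl⟩ := (toKernelPre hk).surjective f
  induction f using Finsupp.induction_linear with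
  | zero => rw [map_zero, UniformSpace.Completion.coe_zero]; exact zero_mem _
  | add f g hf hg => rw [map_add, UniformSpace.Completion.coe_add]; exact add_mem hf hg
  | single s c =>
    have : Finsupp.single s c = c • Finsupp.single s (1 : ℂ) := by simp
    rw [this, map_smul, UniformSpace.Completion.coe_smul]
    exact Submodule.smul_mem _ _ (Submodule.subset_span ⟨s, rfl⟩)

variable {hk}

lemma kernelSpace_ext {η ξ : KernelSpace hk}
    (h : ∀ s, ⟪kernelVec hk s, η⟫_ℂ = ⟪kernelVec hk s, ξ⟫_ℂ) : η = ξ := by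
  refine (kernelVec_dense hk).eq_of_inner_right ℂ fun v hv => ?_
  induction hv using Submodule.span_induction with
  | mem x hx => obtain ⟨s, rfl⟩ := hx; exact h s
  | zero => simp
  | add x y _ _ hx hy => rw [inner_add_left, inner_add_left, hx, hy]
  | smul c x _ hx => rw [inner_smul_left, inner_smul_left, hx]

lemma kernelSpace_hom_ext {T T' : KernelSpace hk →L[ℂ] KernelSpace hk}
    (h : ∀ s, T (kernelVec hk s) = T' (kernelVec hk s)) : T = T' := by
  refine ContinuousLinearMap.ext_on (kernelVec_dense hk) ?_
  rintro _ ⟨s, rfl⟩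
  exact h s

variable (hk)

/-- The map `f ↦ ∑ f(s) v(τ s)`. -/
abbrev kernelSum (τ : S → S) : (S →₀ ℂ) →ₗ[ℂ] KernelSpace hk :=
  Finsupp.linearCombination ℂ fun s => kernelVec hk (τ s)

lemma denseRange_kernelSum_id : DenseRange (kernelSum hk id) := by
  have h := kernelVec_dense hk
  rwa [← Finsupp.range_linearCombination] at h

lemma norm_sq_kernelSum (τ : S → S) (f : S →₀ ℂ) : ‖kernelSum hk τ f‖ ^ 2 =
    (f.sum fun s z => f.sum fun t w => conj z * w * k (τ s) (τ t)).re := by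
  rw [← inner_self_eq_norm_sq (𝕜 := ℂ), Finsupp.linearCombination_apply, Finsupp.sum_inner]
  simp only [Finsupp.inner_sum, inner_smul_left, inner_smul_right, inner_kernelVec]
  simp only [Finsupp.sum, RCLike.re_to_complex]
  refine congrArg _ (Finset.sum_congr rfl fun s _ => Finset.sum_congr rfl fun t _ => ?_)
  ring

/-- A map of the index set that decreases the form, up to a constant, induces an operator. -/
lemma exists_kernelMap (τ : S → S) {C : ℝ} (hC : 0 ≤ C)
    (h : ∀ f : S →₀ ℂ, (f.sum fun s z => f.sum fun t w => conj z * w * k (τ s) (τ t)).re ≤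
      C ^ 2 * (f.sum fun s z => f.sum fun t w => conj z * w * k s t).re) :
    ∃ T : KernelSpace hk →L[ℂ] KernelSpace hk, ‖T‖ ≤ C ∧
      ∀ s, T (kernelVec hk s) = kernelVec hk (τ s) := by
  have hnorm : ∀ f, ‖kernelSum hk τ f‖ ≤ C * ‖kernelSum hk id f‖ := by
    intro f
    rw [← sq_le_sq₀ (norm_nonneg _) (by positivity), mul_pow, norm_sq_kernelSum, norm_sq_kernelSum]
    exact h f
  refine ⟨(kernelSum hk τ).extendOfNorm (kernelSum hk id), LinearMap.opNorm_extendOfNorm_le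
    (denseRange_kernelSum_id hk) hC hnorm, fun s => ?_⟩
  have := LinearMap.extendOfNorm_eq (denseRange_kernelSum_id hk) ⟨C, hnorm⟩ (Finsupp.single s 1)
  simpa using this

/-- A function on the index set that is bounded for the form is represented by a vector. -/
lemma exists_vec_of_bound (φ : S → ℂ) {C : ℝ} (hC : 0 ≤ C)
    (h : ∀ f : S →₀ ℂ, ‖f.sum fun s z => z * φ s‖ ≤ C * ‖kernelSum hk id f‖) :
    ∃ η : KernelSpace hk, ‖η‖ ≤ C ∧ ∀ s, ⟪η, kernelVec hk s⟫_ℂ = φ s := by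
  let ℓ : (S →₀ ℂ) →ₗ[ℂ] ℂ := Finsupp.linearCombination ℂ φ
  have hnorm : ∀ f, ‖ℓ f‖ ≤ C * ‖kernelSum hk id f‖ := h
  refine ⟨(InnerProductSpace.toDual ℂ _).symm (ℓ.extendOfNorm (kernelSum hk id)), ?_, fun s => ?_⟩
  · rw [LinearIsometryEquiv.norm_map]
    exact LinearMap.opNorm_extendOfNorm_le (denseRange_kernelSum_id hk) hC hnorm
  · rw [InnerProductSpace.toDual_symm_apply]
    have := LinearMap.extendOfNorm_eq (denseRange_kernelSum_id hk) ⟨C, hnorm⟩ (Finsupp.single s 1)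
    simpa [ℓ] using this

end KernelSpace

/-! ### The operators of a state of the covariance system -/

section Boundedness

variable {A : Type*} [NonUnitalCStarAlgebra A]

/-- Left multiplication by a square root of `‖a‖² - a* a`, which lives in the unitization. -/
lemma exists_complement (a : A) : ∃ D : A → A, ∀ b c, star (D b) * D c =
    ((‖a‖ : ℂ) ^ 2) • (star b * c) - star (a * b) * (a * c) := by
  let _ := CStarAlgebra.spectralOrder (Unitization ℂ A)
  have := CStarAlgebra.spectralOrderedRing (Unitization ℂ A)
  have h := CStarAlgebra.star_mul_le_algebraMap_norm_sq (a := (a : Unitization ℂ A))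
  rw [← sub_nonneg, CStarAlgebra.nonneg_iff_eq_star_mul_self] at h
  obtain ⟨d, hd⟩ := h
  rw [Unitization.norm_inr (𝕜 := ℂ)] at hd
  refine ⟨fun b => d.fst • b + d.snd * b, fun b c => ?_⟩
  have hD : ∀ b : A, ((d.fst • b + d.snd * b : A) : Unitization ℂ A) = d * (b : Unitization ℂ A) := by
    intro b
    conv_rhs => rw [← Unitization.inl_fst_add_inr_snd_eq d]
    rw [add_mul, Unitization.inl_mul_inr, Unitization.inr_add, Unitization.inr_mul]
  apply Unitization.inr_injective (R := ℂ)
  rw [Unitization.inr_mul, Unitization.inr_star, hD, hD, star_mul, mul_assoc, ← mul_assoc (star d),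
    ← hd]
  simp only [Unitization.inr_sub, Unitization.inr_smul, Unitization.inr_mul, Unitization.inr_star,
    star_mul, sub_mul, mul_sub, Algebra.algebraMap_eq_smul_one]
  simp only [smul_mul_assoc, mul_smul_comm, one_mul, mul_assoc]
  congr 1
  rw [← Complex.ofReal_pow, Complex.coe_smul]

end Boundedness

section GNS

variable {X : Type*} [Group X] [TopologicalSpace X] [MeasurableSpace X]
  {A : Type*} [NonUnitalCStarAlgebra A] {σ : X →* (A ≃⋆ₐ[ℂ] A)} {ω : X → X → (A →L[ℂ] ℂ)}
  {ζ : X → X → 𝓜(ℂ, A)}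

/-- The kernel `⟨v(w, c), v(x, b)⟩ = ω_{x,w}(c* b)`. -/
def covKernel (ω : X → X → (A →L[ℂ] ℂ)) (s t : X × A) : ℂ := ω t.1 s.1 (star s.2 * t.2)

lemma IsCovarianceState.sum_nonneg (hω : IsCovarianceState σ ω) {ι : Type*} (I : Finset ι)
    (c : ι → ℂ) (x : ι → X) (a : ι → A) :
    0 ≤ ∑ i ∈ I, ∑ j ∈ I, c i * star (c j) * ω (x i) (x j) (star (a j) * a i) := by
  have h := hω.positive I.card (fun j => c (I.equivFin.symm j)) (fun j => x (I.equivFin.symm j))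
    (fun j => a (I.equivFin.symm j))
  rw [← Finset.sum_coe_sort I, ← I.equivFin.symm.sum_comp]
  convert! h using 2 with i
  rw [← Finset.sum_coe_sort I, ← I.equivFin.symm.sum_comp]

/-- Hermitian symmetry, from positivity on two points by polarization. -/
lemma IsCovarianceState.conj_apply (hω : IsCovarianceState σ ω) (x y : X) (a b : A) :
    conj (ω x y (star b * a)) = ω y x (star a * b) := by
  have h : ∀ c : Bool → ℂ, _ := fun c => hω.sum_nonneg Finset.univ c (fun i => bif i then x else y)
    (fun i => bif i then a else b)
  have hx := h (fun i => bif i then 1 else 0)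
  have hy := h (fun i => bif i then 0 else 1)
  have h1 := h (fun i => bif i then 1 else 1)
  have hI := h (fun i => bif i then 1 else Complex.I)
  simp [Complex.nonneg_iff] at hx hy h1 hI
  apply Complex.ext
  · simp
    linarith
  · simp
    linarith

lemma isPosDefKernel_covKernel (hω : IsCovarianceState σ ω) : IsPosDefKernel (covKernel ω) where
  conj_symm s t := hω.conj_apply _ _ _ _
  re_nonneg f := by
    have h := (Complex.nonneg_iff.1 (hω.sum_nonneg f.support f Prod.fst Prod.snd)).1
    rw [Finset.sum_comm] at h
    have e : ∀ s t, f s * star (f t) = conj (f t) * f s := fun s t => mul_comm _ _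
    simp only [e] at h
    exact h

/-- Left multiplication by `a` increases the positive form of `ω` at most by the factor `‖a‖²`. -/
lemma IsCovarianceState.sum_mul_le (hω : IsCovarianceState σ ω) {ι : Type*} (I : Finset ι)
    (c : ι → ℂ) (x : ι → X) (a : A) (b : ι → A) :
    (∑ i ∈ I, ∑ j ∈ I, c i * star (c j) * ω (x i) (x j) (star (a * b j) * (a * b i))).re ≤
    ‖a‖ ^ 2 * (∑ i ∈ I, ∑ j ∈ I, c i * star (c j) * ω (x i) (x j) (star (b j) * b i)).re := by
  obtain ⟨D, hD⟩ := exists_complement a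
  have h := (Complex.nonneg_iff.1 (hω.sum_nonneg I c x fun i => D (b i))).1
  simp only [hD, map_sub, map_smul, smul_eq_mul, mul_sub, Finset.sum_sub_distrib] at h
  have h2 : ∑ i ∈ I, ∑ j ∈ I, c i * star (c j) * ((‖a‖ : ℂ) ^ 2 * ω (x i) (x j) (star (b j) * b i)) =
      ((‖a‖ ^ 2 : ℝ) : ℂ) * ∑ i ∈ I, ∑ j ∈ I, c i * star (c j) * ω (x i) (x j) (star (b j) * b i) := by
    simp only [Finset.mul_sum]
    refine Finset.sum_congr rfl fun i _ => Finset.sum_congr rfl fun j _ => ?_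
    push_cast; ring
  rw [h2, Complex.sub_re, Complex.re_ofReal_mul] at h
  linarith

/-- The index map `(x, b) ↦ (x z⁻¹, a σ_z(ζ(x z⁻¹, z) b))`. -/
def covMap (σ : X →* (A ≃⋆ₐ[ℂ] A)) (ζ : X → X → 𝓜(ℂ, A)) (z : X) (a : A) (s : X × A) : X × A :=
  (s.1 * z⁻¹, a * σ z ((ζ (s.1 * z⁻¹) z).fst s.2))

/-- The index map `(w, c) ↦ (w z, ζ(w, z)* σ_z⁻¹(a* c))`, adjoint to `covMap`. -/
def covMapAdj (σ : X →* (A ≃⋆ₐ[ℂ] A)) (ζ : X → X → 𝓜(ℂ, A)) (z : X) (a : A) (s : X × A) : X × A :=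
  (s.1 * z, (star (ζ s.1 z)).fst (σ z⁻¹ (star a * s.2)))

lemma covKernel_covMap (hζ : IsAssociatedMultiplier σ ω ζ) (z : X) (a : A) (s t : X × A) :
    covKernel ω s (covMap σ ζ z a t) = covKernel ω (covMapAdj σ ζ z a s) t := by
  obtain ⟨w, c⟩ := s
  obtain ⟨x, b⟩ := t
  have h1 := hζ.isRightMultiplier.isCentralUnitary (x * z⁻¹) z
  have h2 := hζ.isRightMultiplier.isCentralUnitary w z
  have h3 : star c * (a * σ z ((ζ (x * z⁻¹) z).fst b)) =
      σ z (σ z⁻¹ (star c * a) * (ζ (x * z⁻¹) z).fst b) := by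
    rw [map_mul, aut_apply_inv_apply, mul_assoc]
  simp only [covKernel, covMap, covMapAdj]
  rw [h3, hζ.covariant_apply, inv_mul_cancel_right, h1.mul_fst, h1.star_fst_fst, fst_mul,
    h2.isCentralUnitary_star.star_fst, star_star, ← map_star, star_mul, star_star]

/-- The case `a = 1` of `covMap` preserves the kernel: the operators `U_z` are isometric. -/
lemma covKernel_covMap_covMap (hζ : IsAssociatedMultiplier σ ω ζ) (z : X) (s t : X × A) :
    ω (t.1 * z⁻¹) (s.1 * z⁻¹) (star (σ z ((ζ (s.1 * z⁻¹) z).fst s.2)) *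
      σ z ((ζ (t.1 * z⁻¹) z).fst t.2)) = covKernel ω s t := by
  obtain ⟨w, c⟩ := s
  obtain ⟨x, b⟩ := t
  have h1 := hζ.isRightMultiplier.isCentralUnitary (x * z⁻¹) z
  have h2 := hζ.isRightMultiplier.isCentralUnitary (w * z⁻¹) z
  simp only [covKernel]
  rw [← map_star, ← map_mul, hζ.covariant_apply, inv_mul_cancel_right, inv_mul_cancel_right,
    h1.mul_fst, h1.star_fst_fst, h2.star_fst, fst_mul, h2.fst_star_fst]

/-- The Hilbert space of a state of the covariance system. -/
abbrev GNSSpace (hω : IsCovarianceState σ ω) := KernelSpace (isPosDefKernel_covKernel hω)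

variable (hω : IsCovarianceState σ ω) (hζ : IsAssociatedMultiplier σ ω ζ)

/-- The vectors `v(x, a)`. -/
def gnsVec (x : X) (a : A) : GNSSpace hω := kernelVec _ (x, a)

lemma inner_gnsVec (w x : X) (c b : A) :
    ⟪gnsVec hω w c, gnsVec hω x b⟫_ℂ = ω x w (star c * b) := inner_kernelVec _ _ _

include hζ in
lemma exists_gnsOp (z : X) (a : A) : ∃ T : GNSSpace hω →L[ℂ] GNSSpace hω, ‖T‖ ≤ ‖a‖ ∧
    ∀ s, T (kernelVec _ s) = kernelVec _ (covMap σ ζ z a s) := by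
  refine exists_kernelMap _ _ (norm_nonneg a) fun f => ?_
  have h := hω.sum_mul_le f.support f (fun s => s.1 * z⁻¹) a
    (fun s => σ z ((ζ (s.1 * z⁻¹) z).fst s.2))
  simp only [covKernel_covMap_covMap hζ] at h
  have e : ∀ s t, f s * star (f t) = conj (f t) * f s := fun s t => mul_comm _ _
  simp only [e] at h
  rw [Finset.sum_comm] at h
  nth_rewrite 2 [Finset.sum_comm] at h
  exact h

/-- The operator `L(a) U_z`, where `L(a) v(x, b) = v(x, a b)` and
`U_z v(x, b) = v(x z⁻¹, σ_z(ζ(x z⁻¹, z) b))`. -/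
def gnsOp (z : X) (a : A) : GNSSpace hω →L[ℂ] GNSSpace hω := (exists_gnsOp hω hζ z a).choose

lemma norm_gnsOp_le (z : X) (a : A) : ‖gnsOp hω hζ z a‖ ≤ ‖a‖ :=
  (exists_gnsOp hω hζ z a).choose_spec.1

lemma gnsOp_gnsVec (z : X) (a : A) (x : X) (b : A) : gnsOp hω hζ z a (gnsVec hω x b) =
    gnsVec hω (x * z⁻¹) (a * σ z ((ζ (x * z⁻¹) z).fst b)) :=
  (exists_gnsOp hω hζ z a).choose_spec.2 (x, b)

variable {hω} in
lemma gns_ext {η ξ : GNSSpace hω} (h : ∀ x a, ⟪gnsVec hω x a, η⟫_ℂ = ⟪gnsVec hω x a, ξ⟫_ℂ) :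
    η = ξ := kernelSpace_ext fun s => h s.1 s.2

variable {hω} in
lemma gns_hom_ext {T T' : GNSSpace hω →L[ℂ] GNSSpace hω}
    (h : ∀ x a, T (gnsVec hω x a) = T' (gnsVec hω x a)) : T = T' :=
  kernelSpace_hom_ext fun s => h s.1 s.2

lemma gnsVec_add (x : X) (a b : A) : gnsVec hω x (a + b) = gnsVec hω x a + gnsVec hω x b :=
  gns_ext fun w c => by simp only [inner_add_right, inner_gnsVec, mul_add, map_add]

lemma gnsVec_smul (x : X) (r : ℂ) (a : A) : gnsVec hω x (r • a) = r • gnsVec hω x a :=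
  gns_ext fun w c => by
    simp only [inner_smul_right, inner_gnsVec, mul_smul_comm, map_smul, smul_eq_mul]

/-- `a ↦ L(a) U_z` as a linear map. -/
def gnsOpₗ (z : X) : A →ₗ[ℂ] (GNSSpace hω →L[ℂ] GNSSpace hω) where
  toFun := gnsOp hω hζ z
  map_add' a b := gns_hom_ext fun x c => by
    simp [gnsOp_gnsVec, add_mul, gnsVec_add]
  map_smul' r a := gns_hom_ext fun x c => by
    simp [gnsOp_gnsVec, smul_mul_assoc, gnsVec_smul]

/-- `a ↦ L(a) U_z` as a continuous linear map. -/
def gnsOpL (z : X) : A →L[ℂ] (GNSSpace hω →L[ℂ] GNSSpace hω) :=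
  (gnsOpₗ hω hζ z).mkContinuous 1 fun a => by
    rw [one_mul]; exact norm_gnsOp_le hω hζ z a

@[simp]
lemma gnsOpL_apply (z : X) (a : A) : gnsOpL hω hζ z a = gnsOp hω hζ z a := rfl

lemma adjoint_gnsOp_gnsVec (z : X) (a : A) (w : X) (c : A) :
    (gnsOp hω hζ z a).adjoint (gnsVec hω w c) =
      gnsVec hω (w * z) ((star (ζ w z)).fst (σ z⁻¹ (star a * c))) := by
  refine gns_ext fun x b => ?_
  rw [ContinuousLinearMap.adjoint_inner_right, ← inner_conj_symm, gnsOp_gnsVec,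
    ← inner_conj_symm (gnsVec hω x b), inner_gnsVec, inner_gnsVec]
  congr 1
  exact covKernel_covMap hζ z a (w, c) (x, b)

/-- The operators `L(a) U_y` multiply like the twisted convolution. -/
lemma gnsOp_mul (y z : X) (a b : A) : gnsOp hω hζ y a * gnsOp hω hζ z b =
    gnsOp hω hζ (y * z) (a * mulLeft (leftMultiplier σ ζ y z) (σ y b)) := by
  refine gns_hom_ext fun x c => ?_
  have h1 := hζ.isRightMultiplier.isCentralUnitary (x * z⁻¹ * y⁻¹) y
  have h2 := hζ.isRightMultiplier.isCentralUnitary y z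
  have h3 := hζ.isRightMultiplier.isCentralUnitary (x * z⁻¹) z
  have h4 := hζ.isRightMultiplier.isCentralUnitary (x * z⁻¹ * y⁻¹) (y * z)
  have hc := hζ.isRightMultiplier.cocycle_apply y z (x * z⁻¹ * y⁻¹) ((ζ (x * z⁻¹) z).fst c)
  rw [inv_mul_cancel_right, h2.fst_comm h3, h4.fst_comm h3, h3.star_fst_fst] at hc
  have hc' := congrArg (σ z) hc
  rw [aut_apply_inv_apply] at hc'
  rw [mul_apply_eq_comp, gnsOp_gnsVec, gnsOp_gnsVec, gnsOp_gnsVec, mul_inv_rev,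
    ← mul_assoc x]
  congr 1
  rw [← h1.mul_fst, hc', map_mul, mul_assoc a (mulLeft _ _)]
  congr 1
  change _ = σ (y * z) ((ζ y z).fst ((σ (y * z)).symm (σ y b))) * _
  rw [← map_mul, ← map_mul (σ (y * z)), ← fst_mul, ← h2.mul_fst, map_mul (σ (y * z)),
    aut_symm_apply, aut_apply_inv_apply, aut_mul_apply, h2.fst_comm h4, map_mul (σ y)]

lemma adjoint_gnsOp (z : X) (a : A) : (gnsOp hω hζ z a).adjoint =
    gnsOp hω hζ z⁻¹ ((star (ζ z⁻¹ z)).fst (σ z⁻¹ (star a))) := by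
  refine gns_hom_ext fun w c => ?_
  have h1 := hζ.isRightMultiplier.isCentralUnitary z⁻¹ z
  have h2 := hζ.isRightMultiplier.isCentralUnitary w z
  have hc := hζ.isRightMultiplier.cocycle_apply z⁻¹ z (w * z) (σ z⁻¹ c)
  rw [aut_apply_inv_apply, mul_inv_cancel_right, inv_mul_cancel, hζ.isRightMultiplier.right_one,
    DoubleCentralizer.one_fst, one_apply_eq_self] at hc
  rw [adjoint_gnsOp_gnsVec, gnsOp_gnsVec, inv_inv, hc, h2.isCentralUnitary_star.mul_fst, ← fst_mul,
    h1.mul_fst, h1.star_fst_fst, map_mul (σ z⁻¹)]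

/-- The cyclic vector. If `A` has a unit it is `v(e, 1)`; in general it is the functional
`v(x, a) ↦ ω_{x,e}(a)`, bounded as the limit of the pairings with `v(e, u*)` along an approximate
unit. -/
lemma exists_gnsCyclic : ∃ Ω : GNSSpace hω, ‖Ω‖ ≤ 1 ∧ ∀ x a, ⟪Ω, gnsVec hω x a⟫_ℂ = ω x 1 a := by
  let _ := CStarAlgebra.spectralOrder A
  have := CStarAlgebra.spectralOrderedRing A
  have hu := CStarAlgebra.increasingApproximateUnit A
  suffices h : ∃ Ω : GNSSpace hω, ‖Ω‖ ≤ 1 ∧ ∀ s, ⟪Ω, kernelVec _ s⟫_ℂ = ω s.1 1 s.2 by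
    obtain ⟨Ω, hΩ, hΩv⟩ := h
    exact ⟨Ω, hΩ, fun x a => hΩv (x, a)⟩
  refine exists_vec_of_bound (isPosDefKernel_covKernel hω) (fun s => ω s.1 1 s.2) zero_le_one
    fun f => ?_
  have hlim : Filter.Tendsto (fun u : A => f.sum fun s z => z * ω s.1 1 (u * s.2))
      (CStarAlgebra.approximateUnit A) (𝓝 (f.sum fun s z => z * ω s.1 1 s.2)) :=
    tendsto_finsetSum _ fun s _ => (((ω s.1 1).continuous.tendsto _).comp
      (hu.tendsto_mul_right s.2)).const_mul _
  refine le_of_tendsto hlim.norm ?_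
  filter_upwards [hu.eventually_norm] with u hun
  have h1 : (f.sum fun s z => z * ω s.1 1 (u * s.2)) =
      ⟪gnsVec hω 1 (star u), kernelSum (isPosDefKernel_covKernel hω) id f⟫_ℂ := by
    rw [Finsupp.linearCombination_apply, Finsupp.inner_sum]
    refine Finset.sum_congr rfl fun s _ => ?_
    beta_reduce
    rw [inner_smul_right]
    congr 1
    have := inner_gnsVec hω 1 s.1 (star u) s.2
    rw [star_star] at this
    exact this.symm
  have h2 : ‖gnsVec hω 1 (star u)‖ ≤ 1 := by
    have h3 : ‖gnsVec hω 1 (star u)‖ ^ 2 ≤ 1 := by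
      rw [← inner_self_eq_norm_sq (𝕜 := ℂ), inner_gnsVec]
      refine (Complex.re_le_norm _).trans ((ContinuousLinearMap.le_opNorm _ _).trans ?_)
      rw [hω.normalized.2, one_mul, CStarRing.norm_star_mul_self, norm_star]
      nlinarith [norm_nonneg u]
    nlinarith [norm_nonneg (gnsVec hω 1 (star u))]
  rw [h1]
  exact (norm_inner_le_norm _ _).trans (by gcongr)

lemma gnsOp_cyclic {Ω : GNSSpace hω} (hΩ : ∀ x a, ⟪Ω, gnsVec hω x a⟫_ℂ = ω x 1 a)
    (z : X) (a : A) : gnsOp hω hζ z a Ω = gnsVec hω z⁻¹ ((ζ z z⁻¹).fst a) := by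
  refine gns_ext fun w c => ?_
  have h1 := hζ.isRightMultiplier.isCentralUnitary z⁻¹ z
  have h2 := hζ.isRightMultiplier.isCentralUnitary z z⁻¹
  have h3 := hζ.isRightMultiplier.isCentralUnitary w z
  -- the cocycle identity at `(z, z⁻¹, z)`: `σ_z⁻¹` carries `ζ(z, z⁻¹)` to `ζ(z⁻¹, z)`
  have hc : ∀ b, (ζ z⁻¹ z).fst (σ z⁻¹ ((star (ζ z z⁻¹)).fst b)) = σ z⁻¹ b := by
    intro b
    have hc := hζ.isRightMultiplier.cocycle_apply z⁻¹ z z (σ z⁻¹ ((star (ζ z z⁻¹)).fst b))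
    rw [mul_inv_cancel, inv_mul_cancel, hζ.isRightMultiplier.right_one,
      hζ.isRightMultiplier.one_left, star_one, DoubleCentralizer.one_fst,
      one_apply_eq_self, one_apply_eq_self, aut_apply_inv_apply,
      h2.fst_star_fst] at hc
    exact hc.symm
  have hcov := hζ.covariant_apply w z⁻¹ z (σ z⁻¹ (star ((ζ z z⁻¹).fst a) * c))
  rw [aut_apply_inv_apply, inv_mul_cancel, h1.fst_comm h3.isCentralUnitary_star, h2.star_fst,
    ← fst_mul, hc] at hcov
  rw [← ContinuousLinearMap.adjoint_inner_left, adjoint_gnsOp_gnsVec, ← inner_conj_symm, hΩ,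
    ← hcov, inner_gnsVec, fst_mul, ← h2.star_fst, hω.conj_apply]

lemma inner_cyclic_gnsOp {Ω : GNSSpace hω} (hΩ : ∀ x a, ⟪Ω, gnsVec hω x a⟫_ℂ = ω x 1 a)
    (z : X) (a : A) : ⟪Ω, gnsOp hω hζ z a Ω⟫_ℂ = ω z⁻¹ 1 ((ζ z z⁻¹).fst a) := by
  rw [gnsOp_cyclic hω hζ hΩ, hΩ]

end GNS

/-! ### Strong measurability on compact sets -/

open Filter

section StrongMeasurability

variable {α : Type*} [MeasurableSpace α] {ν : Measure α} {E F : Type*} [NormedAddCommGroup E]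
  [NormedSpace ℂ E] [NormedAddCommGroup F] [NormedSpace ℂ F]

/-- A Carathéodory function composed with a strongly measurable function is strongly measurable. -/
lemma aestronglyMeasurable_clm_apply {Φ : α → E →L[ℂ] F} {h : α → E}
    (hΦ : ∀ a, AEStronglyMeasurable (fun t => Φ t a) ν) (hh : AEStronglyMeasurable h ν) :
    AEStronglyMeasurable (fun t => Φ t (h t)) ν := by
  obtain ⟨h', hh', hae⟩ := hh
  have hlim : ∀ᵐ t ∂ν, Tendsto (fun n => Φ t (hh'.approx n t)) atTop (𝓝 (Φ t (h t))) := by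
    filter_upwards [hae] with t ht
    rw [ht]
    exact ((Φ t).continuous.tendsto _).comp (hh'.tendsto_approx t)
  refine aestronglyMeasurable_of_tendsto_ae atTop (fun n => ?_) hlim
  have hsum : (fun t => Φ t (hh'.approx n t)) = fun t => ∑ b ∈ (hh'.approx n).range,
      ((hh'.approx n) ⁻¹' {b}).indicator (fun t => Φ t b) t := by
    funext t
    rw [Finset.sum_eq_single (hh'.approx n t)]
    · simp
    · intro b _ hb
      exact Set.indicator_of_notMem (fun h => hb h.symm) _
    · intro h
      exact absurd (SimpleFunc.mem_range_self _ t) h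
  rw [hsum]
  exact Finset.aestronglyMeasurable_fun_sum _ fun b _ =>
    (hΦ b).indicator (SimpleFunc.measurableSet_fiber _ _)

/-- Scalar measurability of a family of functionals may be tested on a total set. -/
lemma aestronglyMeasurable_of_dense_span {Φ : α → E →L[ℂ] F} {s : Set E}
    (hs : Dense (Submodule.span ℂ s : Set E))
    (hΦ : ∀ a ∈ s, AEStronglyMeasurable (fun t => Φ t a) ν) (a : E) :
    AEStronglyMeasurable (fun t => Φ t a) ν := by
  have hspan : ∀ b ∈ Submodule.span ℂ s, AEStronglyMeasurable (fun t => Φ t b) ν := by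
    intro b hb
    induction hb using Submodule.span_induction with
    | mem x hx => exact hΦ x hx
    | zero => simpa using aestronglyMeasurable_const
    | add x y _ _ hx hy => simp only [map_add]; exact hx.add hy
    | smul c x _ hx => simp only [map_smul]; exact hx.const_smul c
  obtain ⟨b, hb, hlim⟩ := mem_closure_iff_seq_limit.1 (hs a)
  exact aestronglyMeasurable_of_tendsto_ae atTop (fun n => hspan (b n) (hb n))
    (Eventually.of_forall fun t => ((Φ t).continuous.tendsto a).comp hlim)

end StrongMeasurability

section CompactlyMeasurable

set_option linter.unusedSectionVars false

variable {X : Type*} [Group X] [TopologicalSpace X] [IsTopologicalGroup X]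
  [MeasurableSpace X] [BorelSpace X] {α : Type*} [MeasurableSpace α] {S : ℕ → Set α}

/-- Measurable maps that map each member of an exhausting sequence into a compact set. -/
structure CompactlyMeasurable (S : ℕ → Set α) (φ : α → X) : Prop where
  measurable : Measurable φ
  exists_compact : ∀ n, ∃ K : Set X, IsCompact K ∧ ∀ t ∈ S n, φ t ∈ K

namespace CompactlyMeasurable

lemma const (x : X) : CompactlyMeasurable S fun _ => x :=
  ⟨measurable_const, fun _ => ⟨{x}, isCompact_singleton, fun _ _ => rfl⟩⟩

lemma inv {φ : α → X} (hφ : CompactlyMeasurable S φ) : CompactlyMeasurable S fun t => (φ t)⁻¹ :=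
  ⟨hφ.measurable.inv, fun n => by
    obtain ⟨K, hK, h⟩ := hφ.exists_compact n
    exact ⟨_, hK.image continuous_inv, fun t ht => ⟨_, h t ht, rfl⟩⟩⟩

lemma const_mul (x : X) {φ : α → X} (hφ : CompactlyMeasurable S φ) :
    CompactlyMeasurable S fun t => x * φ t :=
  ⟨hφ.measurable.const_mul x, fun n => by
    obtain ⟨K, hK, h⟩ := hφ.exists_compact n
    exact ⟨_, hK.image (continuous_const_mul x), fun t ht => ⟨_, h t ht, rfl⟩⟩⟩

end CompactlyMeasurable

variable {E : Type*} [NormedAddCommGroup E] {ν : Measure α}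

/-- Measurability on compact sets suffices for composition with maps whose values, on each member of an
exhausting sequence, lie in a compact set. -/
lemma MeasurableOnCompacts.aestronglyMeasurable_comp {F : X × X → E} (hF : MeasurableOnCompacts F)
    (hS : Monotone S) (hν : ∀ᵐ t ∂ν, t ∈ ⋃ n, S n) {φ ψ : α → X} (hφ : CompactlyMeasurable S φ)
    (hψ : CompactlyMeasurable S ψ) : AEStronglyMeasurable (fun t => F (φ t, ψ t)) ν := by
  choose K hK hφK using hφ.exists_compact
  choose L hL hψL using hψ.exists_compact
  refine aestronglyMeasurable_of_tendsto_ae (u := atTop)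
    (f := fun n t => ((K n ∪ L n) ×ˢ (K n ∪ L n)).indicator F (φ t, ψ t))
    (fun n => ((hF _ ((hK n).union (hL n))).comp_measurable
      (hφ.measurable.prodMk hψ.measurable)).aestronglyMeasurable) ?_
  filter_upwards [hν] with t ht
  obtain ⟨n, hn⟩ := Set.mem_iUnion.1 ht
  refine tendsto_const_nhds.congr' ?_
  filter_upwards [eventually_ge_atTop n] with m hm
  have htm := hS hm hn
  have hmem : (φ t, ψ t) ∈ (K m ∪ L m) ×ˢ (K m ∪ L m) :=
    ⟨Or.inl (hφK m t htm), Or.inr (hψL m t htm)⟩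
  exact (Set.indicator_of_mem hmem F).symm

/-- Continuous images of compact sets are separable. -/
lemma measurableOnCompacts_of_continuous [T2Space X] {f : X → E} (hf : Continuous f) :
    MeasurableOnCompacts fun p : X × X => f p.1 := by
  intro K hK
  have h1 : StronglyMeasurable (K.indicator f) := by
    borelize E
    refine stronglyMeasurable_iff_measurable_separable.2
      ⟨hf.measurable.indicator hK.measurableSet, ?_⟩
    refine ((hK.image hf).isSeparable.union (Set.finite_singleton (0 : E)).isSeparable).mono ?_
    rintro _ ⟨x, rfl⟩
    by_cases hx : x ∈ K
    · exact Or.inl ⟨x, hx, (Set.indicator_of_mem hx f).symm⟩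
    · exact Or.inr (Set.indicator_of_notMem hx f)
  have h2 : (K ×ˢ K).indicator (fun p : X × X => f p.1) =
      (Prod.snd ⁻¹' K).indicator fun p : X × X => K.indicator f p.1 := by
    funext p
    by_cases h : p.1 ∈ K <;> by_cases h' : p.2 ∈ K <;> simp [Set.indicator, h, h']
  rw [h2]
  exact (h1.comp_measurable measurable_fst).indicator (measurable_snd hK.measurableSet)

end CompactlyMeasurable

section CovarianceMeasurability

set_option linter.unusedSectionVars false

variable {X : Type*} [Group X] [TopologicalSpace X] [IsTopologicalGroup X] [T2Space X]
  [MeasurableSpace X] [BorelSpace X] {A : Type*} [NonUnitalCStarAlgebra A]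
  {σ : X →* (A ≃⋆ₐ[ℂ] A)} {ω : X → X → (A →L[ℂ] ℂ)} {ζ : X → X → 𝓜(ℂ, A)}
  {α : Type*} [MeasurableSpace α] {S : ℕ → Set α} {ν : Measure α} {φ ψ : α → X} {h : α → A}

lemma aestronglyMeasurable_aut (hσ : ∀ a, Continuous fun x => σ x a)
    (hS : Monotone S) (hν : ∀ᵐ t ∂ν, t ∈ ⋃ n, S n) (hφ : CompactlyMeasurable S φ)
    (hh : AEStronglyMeasurable h ν) : AEStronglyMeasurable (fun t => σ (φ t) (h t)) ν :=
  aestronglyMeasurable_clm_apply (Φ := fun t => autCLM (σ (φ t)))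
    (fun a => (measurableOnCompacts_of_continuous (hσ a)).aestronglyMeasurable_comp hS hν hφ hφ) hh

lemma IsRightMultiplier.aestronglyMeasurable_fst (hζ : IsRightMultiplier σ ζ)
    (hS : Monotone S) (hν : ∀ᵐ t ∂ν, t ∈ ⋃ n, S n) (hφ : CompactlyMeasurable S φ)
    (hψ : CompactlyMeasurable S ψ) (hh : AEStronglyMeasurable h ν) :
    AEStronglyMeasurable (fun t => (ζ (φ t) (ψ t)).fst (h t)) ν :=
  aestronglyMeasurable_clm_apply
    (fun a => (hζ.measurable_left a).aestronglyMeasurable_comp hS hν hφ hψ) hh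

lemma IsRightMultiplier.aestronglyMeasurable_star_fst (hζ : IsRightMultiplier σ ζ)
    (hS : Monotone S) (hν : ∀ᵐ t ∂ν, t ∈ ⋃ n, S n) (hφ : CompactlyMeasurable S φ)
    (hψ : CompactlyMeasurable S ψ) (hh : AEStronglyMeasurable h ν) :
    AEStronglyMeasurable (fun t => (star (ζ (φ t) (ψ t))).fst (h t)) ν :=
  aestronglyMeasurable_clm_apply (fun a => by
    simp only [DoubleCentralizer.star_fst]
    exact ((hζ.measurable_right (star a)).aestronglyMeasurable_comp hS hν hφ hψ).star) hh

lemma IsCovarianceState.aestronglyMeasurable_apply (hω : IsCovarianceState σ ω)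
    (hS : Monotone S) (hν : ∀ᵐ t ∂ν, t ∈ ⋃ n, S n) (hφ : CompactlyMeasurable S φ)
    (hψ : CompactlyMeasurable S ψ) (hh : AEStronglyMeasurable h ν) :
    AEStronglyMeasurable (fun t => ω (φ t) (ψ t) (h t)) ν :=
  aestronglyMeasurable_clm_apply
    (fun a => (hω.measurable a).aestronglyMeasurable_comp hS hν hφ hψ) hh

end CovarianceMeasurability

/-! ### Twisted convolution and involution of integrable functions -/

open Measure

section WellDefined

set_option linter.unusedSectionVars false

variable {X : Type*} [Group X] [TopologicalSpace X] [IsTopologicalGroup X] [LocallyCompactSpace X]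
  [T2Space X] [MeasurableSpace X] [BorelSpace X] (μ : Measure X) [μ.IsHaarMeasure] [μ.Regular]

/-- An open subgroup together with an increasing sequence of compact sets that exhausts it. -/
structure SigmaCompactSubgroup (X : Type*) [Group X] [TopologicalSpace X] where
  G : Subgroup X
  T : ℕ → Set X
  isOpen : IsOpen (G : Set X)
  mono : Monotone T
  isCompact : ∀ n, IsCompact (T n)
  iUnion_eq : ⋃ n, T n = G

variable {μ} in
lemma exists_sigmaCompactSubgroup {E : Type*} [NormedAddCommGroup E] {f g : X → E}
    (hf : Integrable f μ) (hg : Integrable g μ) : ∃ Y : SigmaCompactSubgroup X,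
      (∀ᵐ x ∂μ, x ∉ Y.G → f x = 0) ∧ ∀ᵐ x ∂μ, x ∉ Y.G → g x = 0 := by
  obtain ⟨G, T, hG, hTm, hTc, hT, h⟩ := exists_subgroup_ae_eq_zero (hf.prodMk hg)
  refine ⟨⟨G, T, hG, hTm, hTc, hT⟩, ?_, ?_⟩
  · filter_upwards [h] with x hx hxG using congrArg Prod.fst (hx hxG)
  · filter_upwards [h] with x hx hxG using congrArg Prod.snd (hx hxG)

namespace SigmaCompactSubgroup

variable (Y : SigmaCompactSubgroup X)

/-- The Haar measure of the subgroup, as a measure on the group. -/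
abbrev haar : Measure X := μ.restrict (Y.G : Set X)

instance : SigmaFinite (Y.haar μ) := sigmaFinite_restrict_of_iUnion μ Y.isCompact Y.iUnion_eq

lemma measurableSet : MeasurableSet (Y.G : Set X) := Y.isOpen.measurableSet

lemma ae_mem : ∀ᵐ x ∂Y.haar μ, x ∈ ⋃ n, Y.T n := by
  rw [Y.iUnion_eq]; exact ae_restrict_mem Y.measurableSet

lemma ae_mem_prod : ∀ᵐ p ∂(Y.haar μ).prod (Y.haar μ), p ∈ ⋃ n, Y.T n ×ˢ Y.T n := by
  filter_upwards [quasiMeasurePreserving_fst.ae (Y.ae_mem μ),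
    quasiMeasurePreserving_snd.ae (Y.ae_mem μ)] with p h1 h2
  obtain ⟨m, hm⟩ := Set.mem_iUnion.1 h1
  obtain ⟨n, hn⟩ := Set.mem_iUnion.1 h2
  exact Set.mem_iUnion.2 ⟨max m n, Y.mono (le_max_left m n) hm, Y.mono (le_max_right m n) hn⟩

lemma mono_prod : Monotone fun n => Y.T n ×ˢ Y.T n := fun _ _ h =>
  Set.prod_mono (Y.mono h) (Y.mono h)

lemma compactlyMeasurable_id : CompactlyMeasurable Y.T fun x => x :=
  ⟨measurable_id, fun n => ⟨_, Y.isCompact n, fun _ h => h⟩⟩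

lemma compactlyMeasurable_fst : CompactlyMeasurable (fun n => Y.T n ×ˢ Y.T n) (Prod.fst : X × X → X) :=
  ⟨measurable_fst, fun n => ⟨_, Y.isCompact n, fun _ h => h.1⟩⟩

lemma compactlyMeasurable_snd : CompactlyMeasurable (fun n => Y.T n ×ˢ Y.T n) (Prod.snd : X × X → X) :=
  ⟨measurable_snd, fun n => ⟨_, Y.isCompact n, fun _ h => h.2⟩⟩

variable {E : Type*} [NormedAddCommGroup E] {μ} {f : X → E}

lemma aestronglyMeasurable (h0 : ∀ᵐ x ∂μ, x ∉ Y.G → f x = 0)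
    (hf : AEStronglyMeasurable f (Y.haar μ)) : AEStronglyMeasurable f μ := by
  refine ((aestronglyMeasurable_indicator_iff Y.measurableSet).2 hf).congr ?_
  filter_upwards [h0] with x hx
  by_cases h : x ∈ (Y.G : Set X)
  · exact Set.indicator_of_mem h f
  · rw [Set.indicator_of_notMem h, hx h]

lemma integrable (h0 : ∀ᵐ x ∂μ, x ∉ Y.G → f x = 0) (hf : Integrable f (Y.haar μ)) :
    Integrable f μ :=
  IntegrableOn.integrable_of_ae_notMem_eq_zero hf h0

lemma setIntegral [NormedSpace ℝ E] (h0 : ∀ᵐ x ∂μ, x ∉ Y.G → f x = 0) :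
    ∫ x, f x ∂Y.haar μ = ∫ x, f x ∂μ :=
  setIntegral_eq_integral_of_ae_compl_eq_zero h0

end SigmaCompactSubgroup

variable {μ} {A : Type*} [NonUnitalCStarAlgebra A]
  {σ : X →* (A ≃⋆ₐ[ℂ] A)} {ω : X → X → (A →L[ℂ] ℂ)} {ζ : X → X → 𝓜(ℂ, A)}

lemma mulLeft_leftMultiplier (y z : X) (a : A) : mulLeft (leftMultiplier σ ζ y z) (σ y a) =
    σ y (σ z ((ζ y z).fst (σ z⁻¹ a))) := by
  change σ (y * z) ((ζ y z).fst ((σ (y * z)).symm (σ y a))) = _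
  rw [aut_symm_apply, aut_mul_apply, mul_inv_rev, aut_mul_apply, aut_inv_apply_apply]

lemma integrable_prod_convolution (hσ : ∀ a, Continuous fun x => σ x a)
    (hζ : IsRightMultiplier σ ζ) {f g : X → A} (hf : Integrable f μ) (hg : Integrable g μ)
    (Y : SigmaCompactSubgroup X) : Integrable (fun p : X × X =>
      f p.1 * mulLeft (leftMultiplier σ ζ p.1 p.2) (σ p.1 (g p.2)))
      ((Y.haar μ).prod (Y.haar μ)) := by
  have hf' : Integrable f (Y.haar μ) := hf.restrict
  have hg' : Integrable g (Y.haar μ) := hg.restrict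
  have hS := Y.mono_prod
  have hν := Y.ae_mem_prod μ
  have h1 := Y.compactlyMeasurable_fst
  have h2 := Y.compactlyMeasurable_snd
  refine (hf'.norm.mul_prod hg'.norm).mono ?_ (Eventually.of_forall fun p => ?_)
  · simp only [mulLeft_leftMultiplier]
    exact hf'.1.comp_fst.mul (aestronglyMeasurable_aut hσ hS hν h1 (aestronglyMeasurable_aut hσ hS hν h2
      (hζ.aestronglyMeasurable_fst hS hν h1 h2 (aestronglyMeasurable_aut hσ hS hν h2.inv
        hg'.1.comp_snd))))
  · rw [mulLeft_leftMultiplier, norm_mul ‖f p.1‖, norm_norm, norm_norm]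
    refine (norm_mul_le _ _).trans ?_
    rw [norm_aut_apply, norm_aut_apply, (hζ.isCentralUnitary _ _).norm_fst_apply, norm_aut_apply]

lemma ae_convIntegrand_eq_zero {f g : X → A} (Y : SigmaCompactSubgroup X)
    (hf : ∀ᵐ x ∂μ, x ∉ Y.G → f x = 0) (hg : ∀ᵐ x ∂μ, x ∉ Y.G → g x = 0) {x : X} (hx : x ∉ Y.G) :
    ∀ᵐ y ∂μ, convIntegrand σ (leftMultiplier σ ζ) f g x y = 0 := by
  filter_upwards [hf, (quasiMeasurePreserving_inv_mul_of_regular μ x).ae hg] with y hy hyg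
  by_cases hyG : y ∈ Y.G
  · have : y⁻¹ * x ∉ Y.G := fun h => hx ((Y.G.mul_mem_cancel_left (Y.G.inv_mem hyG)).1 h)
    rw [convIntegrand, hyg this, map_zero, mulLeft, map_zero, mul_zero]
  · rw [convIntegrand, hy hyG, zero_mul]

lemma conv_eq_zero_of_notMem {f g : X → A} (Y : SigmaCompactSubgroup X)
    (hf : ∀ᵐ x ∂μ, x ∉ Y.G → f x = 0) (hg : ∀ᵐ x ∂μ, x ∉ Y.G → g x = 0) {x : X} (hx : x ∉ Y.G) :
    conv μ σ (leftMultiplier σ ζ) f g x = 0 :=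
  integral_eq_zero_of_ae (ae_convIntegrand_eq_zero Y hf hg hx)

/-- The integrability of the convolution is that of its two-variable integrand on an open
`σ`-compact subgroup, transported by the shear. -/
lemma integrable_conv (hσ : ∀ a, Continuous fun x => σ x a)
    (hζ : IsRightMultiplier σ ζ) {f g : X → A} (hf : Integrable f μ) (hg : Integrable g μ) :
    (∀ᵐ x ∂μ, Integrable (convIntegrand σ (leftMultiplier σ ζ) f g x) μ) ∧
      Integrable (conv μ σ (leftMultiplier σ ζ) f g) μ := by
  obtain ⟨Y, hfY, hgY⟩ := exists_sigmaCompactSubgroup hf hg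
  have hint := integrable_prod_convolution hσ hζ hf hg Y
  obtain ⟨h1, h2, -⟩ := integrable_integral_shear μ Y.isOpen Y.mono Y.isCompact Y.iUnion_eq hint
  have h0 : ∀ x, ∀ᵐ y ∂μ, y ∉ Y.G → convIntegrand σ (leftMultiplier σ ζ) f g x y = 0 := by
    intro x
    filter_upwards [hfY] with y hy hyG
    rw [convIntegrand, hy hyG, zero_mul]
  constructor
  · rw [ae_restrict_iff' Y.measurableSet] at h1
    filter_upwards [h1] with x hx
    by_cases hxG : x ∈ Y.G
    · exact Y.integrable (h0 x) (hx hxG)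
    · exact (integrable_zero X A μ).congr ((ae_convIntegrand_eq_zero Y hfY hgY hxG).mono fun y hy => hy.symm)
  · refine Y.integrable (Eventually.of_forall fun x hx =>
      conv_eq_zero_of_notMem Y hfY hgY hx) (h2.congr ?_)
    exact Eventually.of_forall fun x => Y.setIntegral (h0 x)

/-- At `(x, x⁻¹)` the left and the right multiplier agree, because `σ` is trivial at the neutral
element. -/
lemma involution_apply (hζ : IsRightMultiplier σ ζ) (f : X → A) (x : X) :
    involution σ (leftMultiplier σ ζ) f x = (modularCharacter x : ℝ) •
      (star (ζ x x⁻¹)).fst (σ x (star (f x⁻¹))) := by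
  rw [involution, modularFunction, inv_inv]
  congr 1
  simp only [mulLeft, DoubleCentralizer.star_fst, leftMultiplier, autMultiplier_snd,
    mul_inv_cancel, hζ.aut_one, aut_symm_apply, inv_one]

/-- The twisted involution before inversion of the variable and the modular factor. -/
lemma integrable_star_aut_star (hσ : ∀ a, Continuous fun x => σ x a)
    (hζ : IsRightMultiplier σ ζ) {f : X → A} (hf : Integrable f μ) :
    Integrable (fun z => (star (ζ z⁻¹ z)).fst (σ z⁻¹ (star (f z)))) μ := by
  obtain ⟨Y, hfY, -⟩ := exists_sigmaCompactSubgroup hf hf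
  have h1 := Y.compactlyMeasurable_id
  refine hf.norm.mono (Y.aestronglyMeasurable ?_ ?_) (Eventually.of_forall fun z => ?_)
  · filter_upwards [hfY] with z hz hzG
    rw [hz hzG, star_zero, map_zero, map_zero]
  · exact hζ.aestronglyMeasurable_star_fst Y.mono (Y.ae_mem μ) h1.inv h1
      (aestronglyMeasurable_aut hσ Y.mono (Y.ae_mem μ) h1.inv hf.restrict.1.star)
  · rw [(hζ.isCentralUnitary _ _).isCentralUnitary_star.norm_fst_apply, norm_aut_apply, norm_star,
      norm_norm]

lemma integrable_involution (hσ : ∀ a, Continuous fun x => σ x a)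
    (hζ : IsRightMultiplier σ ζ) {f : X → A} (hf : Integrable f μ) :
    Integrable (involution σ (leftMultiplier σ ζ) f) μ := by
  have h := (integrable_modularCharacter_smul_inv (integrable_star_aut_star hσ hζ hf)).1
  refine h.congr (Eventually.of_forall fun x => ?_)
  simp only [involution_apply hζ, inv_inv]

end WellDefined

/-! ### The representation of the convolution algebra -/

section WeakIntegral

variable {α : Type*} [MeasurableSpace α] {ν : Measure α} {H : Type*} [NormedAddCommGroup H]
  [InnerProductSpace ℂ H] {T : α → H →L[ℂ] H} {b : α → ℝ}

lemma integrable_inner_apply (hb : Integrable b ν) (hTb : ∀ t, ‖T t‖ ≤ b t)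
    (hT : ∀ η ψ, AEStronglyMeasurable (fun t => ⟪η, T t ψ⟫_ℂ) ν) (η ψ : H) :
    Integrable (fun t => ⟪η, T t ψ⟫_ℂ) ν := by
  refine ((hb.mul_const ‖ψ‖).const_mul ‖η‖).mono' (hT η ψ) (Eventually.of_forall fun t => ?_)
  exact (norm_inner_le_norm _ _).trans (by gcongr; exact (T t).le_of_opNorm_le (hTb t) ψ)

lemma norm_integral_inner_apply_le (hb : Integrable b ν) (hTb : ∀ t, ‖T t‖ ≤ b t) (η ψ : H) :
    ‖∫ t, ⟪η, T t ψ⟫_ℂ ∂ν‖ ≤ (∫ t, b t ∂ν) * ‖ψ‖ * ‖η‖ := by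
  have h := norm_integral_le_of_norm_le ((hb.mul_const ‖ψ‖).mul_const ‖η‖) (f := fun t => ⟪η, T t ψ⟫_ℂ)
    (Eventually.of_forall fun t => ?_)
  · rwa [integral_mul_const, integral_mul_const] at h
  · rw [mul_comm]
    exact (norm_inner_le_norm _ _).trans (by gcongr; exact (T t).le_of_opNorm_le (hTb t) ψ)

/-- The weak integral of a weakly measurable, norm-integrable family of operators. -/
lemma exists_weakIntegral [CompleteSpace H] (hb : Integrable b ν) (hTb : ∀ t, ‖T t‖ ≤ b t)
    (hT : ∀ η ψ, AEStronglyMeasurable (fun t => ⟪η, T t ψ⟫_ℂ) ν) :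
    ∃ R : H →L[ℂ] H, ‖R‖ ≤ ∫ t, b t ∂ν ∧ ∀ η ψ, ⟪η, R ψ⟫_ℂ = ∫ t, ⟪η, T t ψ⟫_ℂ ∂ν := by
  have hint := integrable_inner_apply hb hTb hT
  have hb0 : 0 ≤ ∫ t, b t ∂ν := integral_nonneg fun t => (norm_nonneg _).trans (hTb t)
  let B : H →ₗ⋆[ℂ] H →ₗ[ℂ] ℂ := LinearMap.mk₂'ₛₗ (starRingEnd ℂ) (RingHom.id ℂ)
    (fun ψ η => conj (∫ t, ⟪η, T t ψ⟫_ℂ ∂ν))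
    (fun ψ ψ' η => by
      simp only [map_add, inner_add_right]
      rw [integral_add (hint _ _) (hint _ _), map_add])
    (fun c ψ η => by
      simp only [map_smul, inner_smul_right]
      rw [integral_const_mul, map_mul, smul_eq_mul])
    (fun ψ η η' => by
      simp only [inner_add_left]
      rw [integral_add (hint _ _) (hint _ _), map_add])
    (fun c ψ η => by
      simp only [inner_smul_left]
      rw [integral_const_mul, map_mul, smul_eq_mul, RCLike.conj_conj, RingHom.id_apply])
  have hB : ∀ ψ η, ‖B ψ η‖ ≤ (∫ t, b t ∂ν) * ‖ψ‖ * ‖η‖ := fun ψ η => by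
    change ‖conj (∫ t, ⟪η, T t ψ⟫_ℂ ∂ν)‖ ≤ _
    rw [RCLike.norm_conj]
    exact norm_integral_inner_apply_le hb hTb η ψ
  let R := InnerProductSpace.continuousLinearMapOfBilin (B.mkContinuous₂ _ hB)
  have hR : ∀ η ψ, ⟪η, R ψ⟫_ℂ = ∫ t, ⟪η, T t ψ⟫_ℂ ∂ν := fun η ψ => by
    rw [← inner_conj_symm, InnerProductSpace.continuousLinearMapOfBilin_apply,
      LinearMap.mkContinuous₂_apply]
    exact RCLike.conj_conj _
  refine ⟨R, R.opNorm_le_bound hb0 fun ψ => ?_, hR⟩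
  have h1 : ‖R ψ‖ * ‖R ψ‖ ≤ (∫ t, b t ∂ν) * ‖ψ‖ * ‖R ψ‖ := by
    rw [← inner_self_eq_norm_mul_norm (𝕜 := ℂ)]
    refine (RCLike.re_le_norm _).trans ?_
    rw [hR]
    exact norm_integral_inner_apply_le hb hTb _ _
  rcases (norm_nonneg (R ψ)).eq_or_lt with h | h
  · rw [← h]; positivity
  · exact le_of_mul_le_mul_right h1 h

end WeakIntegral

section Representation

set_option linter.unusedSectionVars false

variable {X : Type*} [Group X] [TopologicalSpace X] [IsTopologicalGroup X] [LocallyCompactSpace X]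
  [T2Space X] [MeasurableSpace X] [BorelSpace X] {μ : Measure X} [μ.IsHaarMeasure] [μ.Regular]
  {A : Type*} [NonUnitalCStarAlgebra A]
  {σ : X →* (A ≃⋆ₐ[ℂ] A)} {ω : X → X → (A →L[ℂ] ℂ)} {ζ : X → X → 𝓜(ℂ, A)}
  (hω : IsCovarianceState σ ω) (hζ : IsAssociatedMultiplier σ ω ζ)

lemma inner_gnsVec_gnsOp (w : X) (c : A) (y : X) (a : A) (x : X) (b : A) :
    ⟪gnsVec hω w c, gnsOp hω hζ y a (gnsVec hω x b)⟫_ℂ =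
      ω (x * y⁻¹) w (star c * (a * σ y ((ζ (x * y⁻¹) y).fst b))) := by
  rw [gnsOp_gnsVec, inner_gnsVec]

lemma dense_span_gnsVec : Dense (Submodule.span ℂ
    (Set.range fun s : X × A => gnsVec hω s.1 s.2) : Set (GNSSpace hω)) :=
  kernelVec_dense _

lemma gnsOp_zero (z : X) : gnsOp hω hζ z 0 = 0 := map_zero (gnsOpL hω hζ z)

/-- On the total set of vectors `v(x, a)` the matrix coefficients are given by `ω` and `ζ`. -/
lemma aestronglyMeasurable_inner_gnsOp (hσ : ∀ a, Continuous fun x => σ x a) {f : X → A}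
    (hf : Integrable f μ) (η ψ : GNSSpace hω) :
    AEStronglyMeasurable (fun y => ⟪η, gnsOp hω hζ y (f y) ψ⟫_ℂ) μ := by
  obtain ⟨Y, hfY, -⟩ := exists_sigmaCompactSubgroup hf hf
  have h1 := Y.compactlyMeasurable_id
  have hζ' := hζ.isRightMultiplier
  have hvv : ∀ w c x b, AEStronglyMeasurable
      (fun y => ⟪gnsVec hω w c, gnsOp hω hζ y (f y) (gnsVec hω x b)⟫_ℂ) μ := by
    intro w c x b
    refine Y.aestronglyMeasurable ?_ ?_
    · filter_upwards [hfY] with y hy hyG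
      rw [hy hyG, gnsOp_zero, zero_apply, inner_zero_right]
    · simp only [inner_gnsVec_gnsOp]
      have h2 := h1.inv.const_mul x
      exact hω.aestronglyMeasurable_apply Y.mono (Y.ae_mem μ) h2 (.const w)
        (aestronglyMeasurable_const.mul (hf.restrict.1.mul (aestronglyMeasurable_aut hσ Y.mono
          (Y.ae_mem μ) h1 (hζ'.aestronglyMeasurable_fst Y.mono (Y.ae_mem μ) h2 h1
            aestronglyMeasurable_const))))
  have hv : ∀ w c, AEStronglyMeasurable (fun y => ⟪gnsVec hω w c, gnsOp hω hζ y (f y) ψ⟫_ℂ) μ :=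
    fun w c => aestronglyMeasurable_of_dense_span
      (Φ := fun y => (innerSL ℂ (gnsVec hω w c)).comp (gnsOp hω hζ y (f y)))
      (dense_span_gnsVec hω) (by rintro _ ⟨s, rfl⟩; exact hvv w c s.1 s.2) ψ
  have h := aestronglyMeasurable_of_dense_span (ν := μ)
    (Φ := fun y => innerSL ℂ (gnsOp hω hζ y (f y) ψ)) (dense_span_gnsVec hω) (by
      rintro _ ⟨s, rfl⟩
      refine (RCLike.continuous_conj.comp_aestronglyMeasurable (hv s.1 s.2)).congr
        (Eventually.of_forall fun y => ?_)
      exact inner_conj_symm (gnsOp hω hζ y (f y) ψ) _) η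
  refine (RCLike.continuous_conj.comp_aestronglyMeasurable h).congr
    (Eventually.of_forall fun y => ?_)
  exact inner_conj_symm η (gnsOp hω hζ y (f y) ψ)

lemma integrable_inner_gnsOp (hσ : ∀ a, Continuous fun x => σ x a) {f : X → A}
    (hf : Integrable f μ) (η ψ : GNSSpace hω) :
    Integrable (fun y => ⟪η, gnsOp hω hζ y (f y) ψ⟫_ℂ) μ :=
  integrable_inner_apply hf.norm (fun y => norm_gnsOp_le hω hζ y (f y))
    (aestronglyMeasurable_inner_gnsOp hω hζ hσ hf) η ψ

variable (hσ : ∀ a, Continuous fun x => σ x a)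

include hσ in
lemma exists_gnsRep (f : L1 A μ) : ∃ R : GNSSpace hω →L[ℂ] GNSSpace hω, ‖R‖ ≤ ‖f‖ ∧
    ∀ η ψ, ⟪η, R ψ⟫_ℂ = ∫ y, ⟪η, gnsOp hω hζ y (f y) ψ⟫_ℂ ∂μ := by
  rw [L1.norm_eq_integral_norm]
  exact exists_weakIntegral (L1.integrable_coeFn f).norm (fun y => norm_gnsOp_le hω hζ y (f y))
    (aestronglyMeasurable_inner_gnsOp hω hζ hσ (L1.integrable_coeFn f))

/-- The operator `π(f) = ∫ L(f(y)) U_y dy`. -/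
def gnsRepOp (f : L1 A μ) : GNSSpace hω →L[ℂ] GNSSpace hω := (exists_gnsRep hω hζ hσ f).choose

lemma norm_gnsRepOp_le (f : L1 A μ) : ‖gnsRepOp hω hζ hσ f‖ ≤ ‖f‖ :=
  (exists_gnsRep hω hζ hσ f).choose_spec.1

lemma inner_gnsRepOp (f : L1 A μ) (η ψ : GNSSpace hω) :
    ⟪η, gnsRepOp hω hζ hσ f ψ⟫_ℂ = ∫ y, ⟪η, gnsOp hω hζ y (f y) ψ⟫_ℂ ∂μ :=
  (exists_gnsRep hω hζ hσ f).choose_spec.2 η ψ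

lemma gnsRepOp_add (f g : L1 A μ) :
    gnsRepOp hω hζ hσ (f + g) = gnsRepOp hω hζ hσ f + gnsRepOp hω hζ hσ g := by
  refine ContinuousLinearMap.ext fun ψ => ext_inner_left ℂ fun η => ?_
  rw [_root_.add_apply, inner_add_right, inner_gnsRepOp, inner_gnsRepOp,
    inner_gnsRepOp, ← integral_add (integrable_inner_gnsOp hω hζ hσ (L1.integrable_coeFn f) η ψ)
      (integrable_inner_gnsOp hω hζ hσ (L1.integrable_coeFn g) η ψ)]
  refine integral_congr_ae ?_
  filter_upwards [Lp.coeFn_add f g] with y hy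
  rw [hy, Pi.add_apply, ← gnsOpL_apply, map_add, _root_.add_apply, inner_add_right]
  rfl

lemma gnsRepOp_smul (c : ℂ) (f : L1 A μ) :
    gnsRepOp hω hζ hσ (c • f) = c • gnsRepOp hω hζ hσ f := by
  refine ContinuousLinearMap.ext fun ψ => ext_inner_left ℂ fun η => ?_
  rw [_root_.smul_apply, inner_smul_right, inner_gnsRepOp, inner_gnsRepOp,
    ← integral_const_mul]
  refine integral_congr_ae ?_
  filter_upwards [Lp.coeFn_smul c f] with y hy
  rw [hy, Pi.smul_apply, ← gnsOpL_apply, map_smul, _root_.smul_apply, inner_smul_right]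
  rfl

/-- The substitution `x ↦ x⁻¹` turns the integral of `T_x(f⋆(x))` into that of `T_x(f(x))*`. -/
lemma gnsRepOp_involution (f : L1 A μ) :
    gnsRepOp hω hζ hσ (L1.involution μ σ (leftMultiplier σ ζ) f) =
      star (gnsRepOp hω hζ hσ f) := by
  have hζ' := hζ.isRightMultiplier
  have hf := L1.integrable_coeFn f
  refine ContinuousLinearMap.ext fun ψ => ext_inner_left ℂ fun η => ?_
  have hk : ∀ z, ⟪η, gnsOp hω hζ z⁻¹ ((star (ζ z⁻¹ z)).fst (σ z⁻¹ (star (f z)))) ψ⟫_ℂ =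
      conj ⟪ψ, gnsOp hω hζ z (f z) η⟫_ℂ := fun z => by
    rw [← adjoint_gnsOp, ContinuousLinearMap.adjoint_inner_right, inner_conj_symm]
  have hkint : Integrable (fun z => conj ⟪ψ, gnsOp hω hζ z (f z) η⟫_ℂ) μ :=
    (RCLike.conjCLE (K := ℂ)).toContinuousLinearMap.integrable_comp
      (integrable_inner_gnsOp hω hζ hσ hf ψ η)
  have hint := integrable_involution hσ hζ' hf
  rw [ContinuousLinearMap.star_eq_adjoint, ContinuousLinearMap.adjoint_inner_right,
    ← inner_conj_symm _ ψ, inner_gnsRepOp, inner_gnsRepOp, ← integral_conj,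
    ← (integrable_modularCharacter_smul_inv hkint).2]
  refine integral_congr_ae ?_
  rw [L1.involution, dif_pos hint]
  filter_upwards [hint.coeFn_toL1] with x hx
  rw [hx, involution_apply hζ', ← hk, inv_inv, ← gnsOpL_apply, ← Complex.coe_smul, map_smul,
    _root_.smul_apply, inner_smul_right]
  simp

/-- The pairing of `L(f(y)) U_y L(g(z)) U_z` with the vectors `v(x, a)`, for which the product
measurability in `(y, z)` follows from that of `ω`. -/
lemma inner_gnsOp_gnsOp (w : X) (c : A) (y : X) (a : A) (z : X) (a' : A) (x : X) (b : A) :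
    ⟪gnsVec hω w c, gnsOp hω hζ y a (gnsOp hω hζ z a' (gnsVec hω x b))⟫_ℂ =
      ω (x * z⁻¹) (w * y) (star ((star (ζ w y)).fst (σ y⁻¹ (star a * c))) *
        (a' * σ z ((ζ (x * z⁻¹) z).fst b))) := by
  rw [← ContinuousLinearMap.adjoint_inner_left, adjoint_gnsOp_gnsVec, gnsOp_gnsVec, inner_gnsVec]

include hσ in
lemma integrable_prod_inner_gnsOp_gnsOp {f g : X → A} (hf : Integrable f μ) (hg : Integrable g μ)
    (Y : SigmaCompactSubgroup X) (w : X) (c : A) (x : X) (b : A) :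
    Integrable (fun p : X × X => ⟪gnsVec hω w c,
      gnsOp hω hζ p.1 (f p.1) (gnsOp hω hζ p.2 (g p.2) (gnsVec hω x b))⟫_ℂ)
      ((Y.haar μ).prod (Y.haar μ)) := by
  have hf' : Integrable f (Y.haar μ) := hf.restrict
  have hg' : Integrable g (Y.haar μ) := hg.restrict
  have hζ' := hζ.isRightMultiplier
  have hS := Y.mono_prod
  have hν := Y.ae_mem_prod μ
  have h1 := Y.compactlyMeasurable_fst
  have h2 := Y.compactlyMeasurable_snd
  have h3 := h2.inv.const_mul x
  refine (((hf'.norm.mul_prod hg'.norm).mul_const ‖gnsVec hω x b‖).const_mul ‖gnsVec hω w c‖).mono'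
    ?_ (Eventually.of_forall fun p => ?_)
  · simp only [inner_gnsOp_gnsOp]
    exact hω.aestronglyMeasurable_apply hS hν h3 (h1.const_mul w)
      ((hζ'.aestronglyMeasurable_star_fst hS hν (.const w) h1 (aestronglyMeasurable_aut hσ hS hν h1.inv
        (hf'.1.comp_fst.star.mul aestronglyMeasurable_const))).star.mul
        (hg'.1.comp_snd.mul (aestronglyMeasurable_aut hσ hS hν h2
          (hζ'.aestronglyMeasurable_fst hS hν h3 h2 aestronglyMeasurable_const))))
  · refine (norm_inner_le_norm _ _).trans ?_
    rw [mul_assoc ‖f p.1‖]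
    gcongr
    refine (ContinuousLinearMap.le_of_opNorm_le _ (norm_gnsOp_le hω hζ _ _) _).trans ?_
    gcongr
    exact ContinuousLinearMap.le_of_opNorm_le _ (norm_gnsOp_le hω hζ _ _) _

/-- Fubini's theorem for the shear, applied to matrix coefficients. -/
lemma gnsRepOp_conv (f g : L1 A μ) :
    gnsRepOp hω hζ hσ (L1.conv μ σ (leftMultiplier σ ζ) f g) =
      gnsRepOp hω hζ hσ f * gnsRepOp hω hζ hσ g := by
  have hζ' := hζ.isRightMultiplier
  have hf := L1.integrable_coeFn f
  have hg := L1.integrable_coeFn g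
  obtain ⟨Y, hfY, hgY⟩ := exists_sigmaCompactSubgroup hf hg
  obtain ⟨hc1, hc2⟩ := integrable_conv hσ hζ' hf hg
  refine gns_hom_ext fun x b => gns_ext fun w c => ?_
  have hprod := integrable_prod_inner_gnsOp_gnsOp hω hζ hσ hf hg Y w c x b
  have hshear := (integrable_integral_shear μ Y.isOpen Y.mono Y.isCompact Y.iUnion_eq hprod).2.2
  set v := gnsVec hω w c
  set v' := gnsVec hω x b
  have hmul : ∀ x y, ⟪v, gnsOp hω hζ y (f y) (gnsOp hω hζ (y⁻¹ * x) (g (y⁻¹ * x)) v')⟫_ℂ =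
      ⟪v, gnsOp hω hζ x (convIntegrand σ (leftMultiplier σ ζ) f g x y) v'⟫_ℂ := by
    intro x y
    rw [← mul_apply_eq_comp, gnsOp_mul, mul_inv_cancel_left]
    rfl
  have hleft : ∀ y, y ∉ Y.G → f y = 0 → ∀ ψ, ⟪v, gnsOp hω hζ y (f y) ψ⟫_ℂ = 0 := by
    intro y _ hy ψ
    rw [hy, gnsOp_zero, zero_apply, inner_zero_right]
  -- both sides are the integral over the product of the subgroup with itself
  trans ∫ p, ⟪v, gnsOp hω hζ p.1 (f p.1) (gnsOp hω hζ p.2 (g p.2) v')⟫_ℂ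
    ∂((Y.haar μ).prod (Y.haar μ))
  · rw [← hshear, inner_gnsRepOp, L1.conv, dif_pos hc2]
    have hconv0 : ∀ x, x ∉ Y.G → conv μ σ (leftMultiplier σ ζ) f g x = 0 :=
      fun x hx => conv_eq_zero_of_notMem Y hfY hgY hx
    have hint : ∀ᵐ x ∂μ, ⟪v, gnsOp hω hζ x (hc2.toL1 _ x) v'⟫_ℂ =
        ⟪v, gnsOp hω hζ x (conv μ σ (leftMultiplier σ ζ) f g x) v'⟫_ℂ := by
      filter_upwards [hc2.coeFn_toL1] with x hx
      rw [hx]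
    rw [integral_congr_ae hint, ← Y.setIntegral (Eventually.of_forall fun x hx => by
      rw [hconv0 x hx, gnsOp_zero, zero_apply, inner_zero_right])]
    refine integral_congr_ae (ae_restrict_of_ae ?_)
    filter_upwards [hc1] with x hx
    simp only [hmul]
    rw [Y.setIntegral (by
      filter_upwards [hfY] with y hy hyG
      rw [convIntegrand, hy hyG, zero_mul, gnsOp_zero, zero_apply,
        inner_zero_right])]
    let Λ : A →L[ℂ] ℂ := (innerSL ℂ v).comp
      ((ContinuousLinearMap.apply ℂ _ v').comp (gnsOpL hω hζ x))
    exact (Λ.integral_comp_comm hx).symm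
  · rw [integral_prod_symm _ hprod, mul_apply_eq_comp, ← ContinuousLinearMap.adjoint_inner_left,
      inner_gnsRepOp, ← Y.setIntegral (μ := μ)]
    · refine integral_congr_ae (Eventually.of_forall fun z => ?_)
      beta_reduce
      rw [ContinuousLinearMap.adjoint_inner_left, inner_gnsRepOp]
      refine Y.setIntegral ?_
      filter_upwards [hfY] with y hy hyG using hleft y hyG (hy hyG) _
    · filter_upwards [hgY] with z hz hzG
      rw [hz hzG, gnsOp_zero, zero_apply, inner_zero_right]

end Representation

section GNSRepresentation

universe u v

variable {X : Type u} [Group X] [TopologicalSpace X] [IsTopologicalGroup X] [LocallyCompactSpace X]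
  [T2Space X] [MeasurableSpace X] [BorelSpace X] {μ : Measure X} [μ.IsHaarMeasure] [μ.Regular]
  {A : Type v} [NonUnitalCStarAlgebra A]
  {σ : X →* (A ≃⋆ₐ[ℂ] A)} {ω : X → X → (A →L[ℂ] ℂ)} {ζ : X → X → 𝓜(ℂ, A)}

/-- The representation of `L¹(X, A)` on the Hilbert space of a state of the covariance system. -/
def gnsRep (hω : IsCovarianceState σ ω) (hζ : IsAssociatedMultiplier σ ω ζ)
    (hσ : ∀ a, Continuous fun x => σ x a) : L1Rep μ σ (leftMultiplier σ ζ) where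
  H := GNSSpace hω
  rep :=
    { toFun := gnsRepOp hω hζ hσ
      map_add' := gnsRepOp_add hω hζ hσ
      map_smul' := gnsRepOp_smul hω hζ hσ }
  norm_rep_le := norm_gnsRepOp_le hω hζ hσ
  map_conv := gnsRepOp_conv hω hζ hσ
  map_involution := gnsRepOp_involution hω hζ hσ

end GNSRepresentation

/-! ### The functional and its extension -/

section StateFunctional

set_option linter.unusedSectionVars false

variable {X : Type*} [Group X] [TopologicalSpace X] [IsTopologicalGroup X] [LocallyCompactSpace X]
  [T2Space X] [MeasurableSpace X] [BorelSpace X] {μ : Measure X} [μ.IsHaarMeasure] [μ.Regular]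
  {A : Type*} [NonUnitalCStarAlgebra A]
  {σ : X →* (A ≃⋆ₐ[ℂ] A)} {ω : X → X → (A →L[ℂ] ℂ)} {ζ : X → X → 𝓜(ℂ, A)}
  (hω : IsCovarianceState σ ω) (hζ : IsAssociatedMultiplier σ ω ζ)
  (hσ : ∀ a, Continuous fun x => σ x a)
  {Ω : GNSSpace hω} (hΩ : ‖Ω‖ ≤ 1) (hΩv : ∀ x a, ⟪Ω, gnsVec hω x a⟫_ℂ = ω x 1 a)

/-- The functional `S ↦ ⟨Ω, S Ω⟩` on operators. -/
def vectorFunctional {H : Type*} [NormedAddCommGroup H] [InnerProductSpace ℂ H] (Ω : H) :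
    (H →L[ℂ] H) →L[ℂ] ℂ :=
  (innerSL ℂ Ω).comp (ContinuousLinearMap.apply ℂ H Ω)

lemma vectorFunctional_apply {H : Type*} [NormedAddCommGroup H] [InnerProductSpace ℂ H] (Ω : H)
    (S : H →L[ℂ] H) : vectorFunctional Ω S = ⟪Ω, S Ω⟫_ℂ := rfl

lemma norm_vectorFunctional_apply_le {H : Type*} [NormedAddCommGroup H] [InnerProductSpace ℂ H]
    {Ω : H} (hΩ : ‖Ω‖ ≤ 1) (S : H →L[ℂ] H) : ‖vectorFunctional Ω S‖ ≤ ‖S‖ := by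
  rw [vectorFunctional_apply]
  calc ‖⟪Ω, S Ω⟫_ℂ‖ ≤ ‖Ω‖ * (‖S‖ * ‖Ω‖) :=
        (norm_inner_le_norm _ _).trans (by gcongr; exact S.le_opNorm Ω)
    _ ≤ 1 * (‖S‖ * 1) := by gcongr
    _ = ‖S‖ := by ring

lemma vectorFunctional_star_mul_self_nonneg {H : Type*} [NormedAddCommGroup H]
    [InnerProductSpace ℂ H] [CompleteSpace H] (Ω : H) (S : H →L[ℂ] H) :
    0 ≤ vectorFunctional Ω (star S * S) := by
  rw [vectorFunctional_apply, mul_apply_eq_comp, ContinuousLinearMap.star_eq_adjoint,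
    ContinuousLinearMap.adjoint_inner_right, inner_self_eq_norm_sq_to_K]
  rw [← RCLike.ofReal_pow]
  exact Complex.zero_le_real.2 (sq_nonneg ‖S Ω‖)

include hΩv in
lemma stateIntegrand_eq (f : X → A) (x : X) : stateIntegrand ω (leftMultiplier σ ζ) f x =
    (modularCharacter x : ℝ) • ⟪Ω, gnsOp hω hζ x⁻¹ (f x⁻¹) Ω⟫_ℂ := by
  rw [stateIntegrand, modularFunction, inv_inv, inner_cyclic_gnsOp hω hζ hΩv, inv_inv]
  congr 2
  simp only [mulLeft, leftMultiplier, autMultiplier_fst, inv_mul_cancel, aut_symm_apply, inv_one,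
    aut_one_apply]

include hω hζ hσ in
lemma integrable_stateIntegrand {f : X → A} (hf : Integrable f μ) :
    Integrable (stateIntegrand ω (leftMultiplier σ ζ) f) μ := by
  obtain ⟨Ω, -, hΩv⟩ := exists_gnsCyclic hω
  exact (integrable_modularCharacter_smul_inv (integrable_inner_gnsOp hω hζ hσ hf Ω Ω)).1.congr
    (Eventually.of_forall fun x => (stateIntegrand_eq hω hζ hΩv f x).symm)

include hσ hΩv in
lemma integral_stateIntegrand {f : X → A} (hf : Integrable f μ) :
    ∫ x, stateIntegrand ω (leftMultiplier σ ζ) f x ∂μ =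
      ∫ y, ⟪Ω, gnsOp hω hζ y (f y) Ω⟫_ℂ ∂μ := by
  simp only [stateIntegrand_eq hω hζ hΩv]
  exact (integrable_modularCharacter_smul_inv (integrable_inner_gnsOp hω hζ hσ hf Ω Ω)).2

/-- The representation `f ↦ π(f)` as a continuous linear map. -/
def gnsRepL : L1 A μ →L[ℂ] (GNSSpace hω →L[ℂ] GNSSpace hω) :=
  LinearMap.mkContinuous
    { toFun := gnsRepOp hω hζ hσ
      map_add' := gnsRepOp_add hω hζ hσ
      map_smul' := gnsRepOp_smul hω hζ hσ } 1 fun f => by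
    rw [one_mul]; exact norm_gnsRepOp_le hω hζ hσ f

/-- The functional `f ↦ ⟨Ω, π(f) Ω⟩` on `L¹(X, A)`. -/
def stateFunctional (Ω : GNSSpace hω) : L1 A μ →L[ℂ] ℂ :=
  (vectorFunctional Ω).comp (gnsRepL hω hζ hσ)

lemma stateFunctional_apply (f : L1 A μ) : stateFunctional hω hζ hσ Ω f =
    vectorFunctional Ω (gnsRepOp hω hζ hσ f) := rfl

include hΩv in
lemma stateFunctional_eq_integral (f : L1 A μ) : stateFunctional hω hζ hσ Ω f =
    ∫ x, stateIntegrand ω (leftMultiplier σ ζ) f x ∂μ := by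
  rw [integral_stateIntegrand hω hζ hσ hΩv (L1.integrable_coeFn f), stateFunctional_apply,
    vectorFunctional_apply, inner_gnsRepOp]

lemma stateFunctional_nonneg (f : L1 A μ) : 0 ≤ stateFunctional hω hζ hσ Ω
    (L1.conv μ σ (leftMultiplier σ ζ) (L1.involution μ σ (leftMultiplier σ ζ) f) f) := by
  rw [stateFunctional_apply, gnsRepOp_conv, gnsRepOp_involution]
  exact vectorFunctional_star_mul_self_nonneg _ _

include hΩ in
lemma norm_stateFunctional_le : ‖stateFunctional hω hζ hσ Ω (μ := μ)‖ ≤ 1 := by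
  refine ContinuousLinearMap.opNorm_le_bound _ zero_le_one fun f => ?_
  rw [one_mul]
  exact (norm_vectorFunctional_apply_le hΩ _).trans (norm_gnsRepOp_le hω hζ hσ f)

include hω hζ in
/-- The functionals `ω_{x,e}` are contractive, since `ω_{x,e}(a)` is a matrix coefficient at `Ω`. -/
lemma norm_apply_one_le (x : X) (a : A) : ‖ω x 1 a‖ ≤ ‖a‖ := by
  obtain ⟨Ω, hΩ, hΩv⟩ := exists_gnsCyclic hω
  have h1 := hζ.isRightMultiplier.isCentralUnitary x⁻¹ x
  have h := inner_cyclic_gnsOp hω hζ hΩv x⁻¹ ((star (ζ x⁻¹ x)).fst a)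
  rw [inv_inv, h1.fst_star_fst] at h
  rw [← h, ← h1.isCentralUnitary_star.norm_fst_apply a]
  exact (norm_vectorFunctional_apply_le hΩ _).trans (norm_gnsOp_le hω hζ _ _)

include hΩv in
lemma tendsto_inner_cyclic_gnsOp (a : A) :
    Tendsto (fun y => ⟪Ω, gnsOp hω hζ y a Ω⟫_ℂ) (𝓝 1) (𝓝 (ω 1 1 a)) := by
  simp only [inner_cyclic_gnsOp hω hζ hΩv]
  have hinv : Tendsto (fun y : X => y⁻¹) (𝓝 1) (𝓝 1) := by
    simpa using (continuous_inv (G := X)).tendsto 1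
  have h1 : Tendsto (fun y => ω y⁻¹ 1 a) (𝓝 1) (𝓝 (ω 1 1 a)) := by
    obtain ⟨V, hV, hc⟩ := hω.continuous_near_one a
    have h := (hc.continuousAt hV).tendsto
    exact h.comp (hinv.prodMk_nhds tendsto_const_nhds)
  have h2 : Tendsto (fun y => (ζ y y⁻¹).fst a - a) (𝓝 1) (𝓝 0) := by
    obtain ⟨V, hV, hc⟩ := hζ.isRightMultiplier.continuous_near_one
    have h := ((hc a).1.continuousAt hV).tendsto
    have h' := h.comp (tendsto_id.prodMk_nhds hinv)
    simp only [hζ.isRightMultiplier.right_one, mulLeft, DoubleCentralizer.one_fst,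
      one_apply_eq_self] at h'
    simpa using h'.sub_const a
  have h3 : Tendsto (fun y => ω y⁻¹ 1 ((ζ y y⁻¹).fst a - a)) (𝓝 1) (𝓝 0) :=
    squeeze_zero_norm (fun y => norm_apply_one_le hω hζ _ _) (tendsto_zero_iff_norm_tendsto_zero.1 h2)
  simpa using h3.add h1

include hΩv in
/-- Functions concentrated near the neutral element, `f = 1_V ⊗ a`, give the lower bound. -/
lemma one_le_norm_stateFunctional : 1 ≤ ‖stateFunctional hω hζ hσ Ω (μ := μ)‖ := by
  rw [← hω.normalized.2]
  refine ContinuousLinearMap.opNorm_le_bound _ (norm_nonneg _) fun a => ?_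
  refine le_of_forall_pos_le_add fun ε hε => ?_
  have hk := Metric.tendsto_nhds.1 (tendsto_inner_cyclic_gnsOp hω hζ hΩv a) ε hε
  obtain ⟨K, hK, hK1⟩ := exists_compact_mem_nhds (1 : X)
  obtain ⟨V, hVsub, hVo, hV1⟩ := mem_nhds_iff.1 (Filter.inter_mem hk hK1)
  have hVfin : μ V ≠ ∞ := measure_ne_top_of_subset (fun y hy => (hVsub hy).2) hK.measure_ne_top
  have hVpos : 0 < μ.real V := ENNReal.toReal_pos (hVo.measure_pos μ ⟨1, hV1⟩).ne' hVfin
  let f : L1 A μ := indicatorConstLp 1 hVo.measurableSet hVfin a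
  have hf : ‖f‖ = ‖a‖ * μ.real V := by
    rw [norm_indicatorConstLp one_ne_zero ENNReal.one_ne_top]
    simp
  have hval : stateFunctional hω hζ hσ Ω f = ∫ y in V, ⟪Ω, gnsOp hω hζ y a Ω⟫_ℂ ∂μ := by
    rw [stateFunctional_apply, vectorFunctional_apply, inner_gnsRepOp,
      ← integral_indicator hVo.measurableSet]
    refine integral_congr_ae ?_
    filter_upwards [indicatorConstLp_coeFn (p := 1) (hs := hVo.measurableSet) (hμs := hVfin) (c := a)]
      with y hy
    rw [hy]
    by_cases h : y ∈ V
    · rw [Set.indicator_of_mem h, Set.indicator_of_mem h]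
    · rw [Set.indicator_of_notMem h, Set.indicator_of_notMem h, gnsOp_zero, zero_apply,
        inner_zero_right]
  have hint : IntegrableOn (fun y => ⟪Ω, gnsOp hω hζ y a Ω⟫_ℂ) V μ := by
    refine (integrable_inner_gnsOp hω hζ hσ (L1.integrable_coeFn f) Ω Ω).restrict.congr ?_
    filter_upwards [ae_restrict_mem hVo.measurableSet, ae_restrict_of_ae
      (indicatorConstLp_coeFn (p := 1) (hs := hVo.measurableSet) (hμs := hVfin) (c := a))] with y hyV hy
    rw [hy, Set.indicator_of_mem hyV]
  have hdiff : ‖stateFunctional hω hζ hσ Ω f - μ.real V • ω 1 1 a‖ ≤ ε * μ.real V := by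
    rw [hval, ← setIntegral_const, ← integral_sub hint (integrableOn_const hVfin)]
    refine norm_setIntegral_le_of_norm_le_const hVfin.lt_top fun y hy => ?_
    rw [← dist_eq_norm]
    exact (hVsub hy).1.le
  have hle := (stateFunctional hω hζ hσ Ω (μ := μ)).le_opNorm f
  have htri := norm_sub_norm_le (μ.real V • ω 1 1 a) (stateFunctional hω hζ hσ Ω f)
  rw [norm_sub_rev, norm_smul, Real.norm_of_nonneg hVpos.le] at htri
  rw [hf] at hle
  -- `μ(V) ‖ω_{e,e}(a)‖ - ε μ(V) ≤ ‖ω̄(1_V ⊗ a)‖ ≤ ‖ω̄‖ ‖a‖ μ(V)`; divide by `μ(V)`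
  refine le_of_mul_le_mul_left ?_ hVpos
  nlinarith

end StateFunctional

section CrossedProductState

universe u v

variable {X : Type u} [Group X] [TopologicalSpace X] [IsTopologicalGroup X] [LocallyCompactSpace X]
  [MeasurableSpace X] {μ : Measure X} {A : Type v} [NonUnitalCStarAlgebra A]
  {σ : X → A ≃⋆ₐ[ℂ] A} {ξ : X → X → 𝓜(ℂ, A)}

/-- The value at a single representation of an element of the product of all representations. -/
def RepProduct.eval (π : L1Rep μ σ ξ) (S : RepProduct μ σ ξ) : π.H →L[ℂ] π.H :=
  (show lp (fun π : L1Rep μ σ ξ => π.H →L[ℂ] π.H) ∞ from S) π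

lemma RepProduct.norm_eval_le (π : L1Rep μ σ ξ) (S : RepProduct μ σ ξ) :
    ‖RepProduct.eval π S‖ ≤ ‖S‖ :=
  lp.norm_apply_le_norm ENNReal.top_ne_zero
    (show lp (fun π : L1Rep μ σ ξ => π.H →L[ℂ] π.H) ∞ from S) π

lemma norm_universalRep_le (f : L1 A μ) : ‖universalRep μ σ ξ f‖ ≤ ‖f‖ :=
  lp.norm_le_of_forall_le (norm_nonneg f) fun π => π.norm_rep_le f

/-- The vector functional of a representation of `L¹(X, A)` on the twisted crossed product. -/
def crossedProductFunctional (π : L1Rep μ σ ξ) (Ω : π.H) (hΩ : ‖Ω‖ ≤ 1) :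
    CrossedProduct μ σ ξ →L[ℂ] ℂ :=
  LinearMap.mkContinuous
    { toFun := fun S => vectorFunctional Ω (RepProduct.eval π (S : RepProduct μ σ ξ))
      map_add' := fun S S' => map_add (vectorFunctional Ω) _ _
      map_smul' := fun c S => map_smul (vectorFunctional Ω) c _ } 1 fun S => by
    rw [one_mul]
    exact (norm_vectorFunctional_apply_le hΩ _).trans (RepProduct.norm_eval_le π _)

lemma crossedProductFunctional_nonneg (π : L1Rep μ σ ξ) (Ω : π.H) (hΩ : ‖Ω‖ ≤ 1)
    (S : CrossedProduct μ σ ξ) : 0 ≤ crossedProductFunctional π Ω hΩ (star S * S) :=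
  vectorFunctional_star_mul_self_nonneg Ω (RepProduct.eval π (S : RepProduct μ σ ξ))

lemma norm_crossedProductFunctional_le (π : L1Rep μ σ ξ) (Ω : π.H) (hΩ : ‖Ω‖ ≤ 1) :
    ‖crossedProductFunctional π Ω hΩ‖ ≤ 1 :=
  LinearMap.mkContinuous_norm_le _ zero_le_one _

/-- The norm of a functional on `L¹(X, A)` is a lower bound for that of its extension, since the
canonical map is contractive. -/
lemma isState_crossedProductFunctional (π : L1Rep μ σ ξ) (Ω : π.H) (hΩ : ‖Ω‖ ≤ 1)
    {φ : L1 A μ →L[ℂ] ℂ} (hφ : 1 ≤ ‖φ‖) (h : ∀ f, φ f = vectorFunctional Ω (π.rep f)) :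
    IsState (crossedProductFunctional π Ω hΩ) := by
  refine ⟨crossedProductFunctional_nonneg π Ω hΩ,
    (norm_crossedProductFunctional_le π Ω hΩ).antisymm (hφ.trans ?_)⟩
  refine φ.opNorm_le_bound (norm_nonneg _) fun f => ?_
  have h1 : φ f = crossedProductFunctional π Ω hΩ (toCrossedProduct μ σ ξ f) := h f
  rw [h1]
  refine (ContinuousLinearMap.le_opNorm _ _).trans ?_
  gcongr
  exact norm_universalRep_le f

end CrossedProductState

end TwistedCovariance

end

theorem mainTheorem2
    {X : Type*} [Group X] [TopologicalSpace X] [IsTopologicalGroup X] [LocallyCompactSpace X]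
    [T2Space X] [MeasurableSpace X] [BorelSpace X]
    (μ : Measure X) [μ.IsHaarMeasure] [μ.Regular]
    {A : Type*} [NonUnitalCStarAlgebra A]
    (σ : X →* (A ≃⋆ₐ[ℂ] A)) (hσ : ∀ a, Continuous fun x => σ x a)
    (ω : X → X → (A →L[ℂ] ℂ)) (hω : TwistedCovariance.IsCovarianceState σ ω)
    (ζ : X → X → 𝓜(ℂ, A)) (hζ : TwistedCovariance.IsAssociatedMultiplier σ ω ζ)
    (ξ : X → X → 𝓜(ℂ, A)) (hξ : ξ = TwistedCovariance.leftMultiplier σ ζ) :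
    -- the product and the involution of `L¹(X, A)` are well defined
    (∀ f g : TwistedCovariance.L1 A μ,
      (∀ᵐ x ∂μ, Integrable (TwistedCovariance.convIntegrand σ ξ f g x) μ) ∧
      Integrable (TwistedCovariance.conv μ σ ξ f g) μ) ∧
    (∀ f : TwistedCovariance.L1 A μ, Integrable (TwistedCovariance.involution σ ξ f) μ) ∧
    -- the functional is well defined, bounded, positive, normalized, and extends to a state
    (∀ f : TwistedCovariance.L1 A μ, Integrable (TwistedCovariance.stateIntegrand ω ξ f) μ) ∧
    ∃ ωbar : TwistedCovariance.L1 A μ →L[ℂ] ℂ,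
      (∀ f, ωbar f = ∫ x, TwistedCovariance.stateIntegrand ω ξ f x ∂μ) ∧
      (∀ f, 0 ≤ ωbar (TwistedCovariance.L1.conv μ σ ξ (TwistedCovariance.L1.involution μ σ ξ f) f)) ∧
      ‖ωbar‖ = 1 ∧
      ∃ φ : TwistedCovariance.CrossedProduct μ σ ξ →L[ℂ] ℂ,
        TwistedCovariance.IsState φ ∧
        ∀ f, φ (TwistedCovariance.toCrossedProduct μ σ ξ f) = ωbar f := by
  subst hξ
  have hζ' := hζ.isRightMultiplier
  obtain ⟨Ω, hΩ, hΩv⟩ := TwistedCovariance.exists_gnsCyclic hω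
  refine ⟨fun f g => TwistedCovariance.integrable_conv hσ hζ' (L1.integrable_coeFn f) (L1.integrable_coeFn g),
    fun f => TwistedCovariance.integrable_involution hσ hζ' (L1.integrable_coeFn f),
    fun f => TwistedCovariance.integrable_stateIntegrand hω hζ hσ (L1.integrable_coeFn f),
    TwistedCovariance.stateFunctional hω hζ hσ Ω, TwistedCovariance.stateFunctional_eq_integral hω hζ hσ hΩv,
    TwistedCovariance.stateFunctional_nonneg hω hζ hσ, ?_, TwistedCovariance.crossedProductFunctional (TwistedCovariance.gnsRep hω hζ hσ) Ω hΩ, ?_,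
    fun f => rfl⟩
  · exact (TwistedCovariance.norm_stateFunctional_le hω hζ hσ hΩ).antisymm
      (TwistedCovariance.one_le_norm_stateFunctional hω hζ hσ hΩv)
  · exact TwistedCovariance.isState_crossedProductFunctional (TwistedCovariance.gnsRep hω hζ hσ) Ω hΩ
      (TwistedCovariance.one_le_norm_stateFunctional hω hζ hσ hΩv) fun f => rfl
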